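/- Let $n\ge 1$, $0<s<1$, let $\Omega\subset\mathbb{R}^n$ be a domain (nonempty, open, connected), let $\vec b\in C^1(\Omega;\mathbb{R}^n)$ and $c\in L^\infty(\Omega)$ with $\|\vec b\|_{C^1(\Omega)}+\|c\|_{L^\infty(\Omega)}<\infty$. Let $$\mathcal{L}_{2s}=\Big\{u:\mathbb{R}^n\to\mathbb{R}\ \text{measurable}\ :\ \int_{\mathbb{R}^n}\frac{|u(y)|}{1+|y|^{n+2s}}\,dy<\infty\Big\},$$ and for $\varphi\in C_0^\infty(\mathbb{R}^n)$ let $$(-\Delta)^s\varphi(x)=C_{n,s}\,\mathrm{P.V.}\!\int_{\mathbb{R}^n}\frac{\varphi(x)-\varphi(y)}{|x-y|^{n+2s}}\,dy,\qquad C_{n,s}=\frac{4^s\,s\,\Gamma(\frac n2+s)}{\pi^{n/2}\,\Gamma(1-s)}.$$ For $u\in\mathcal{L}_{2s}$ and $f\in L^1_{\rm loc}(\Omega)$, we say that $(-\Delta)^su+\vec b\cdot\nabla u+cu\le f$ in $\mathcal{D}'(\Omega)$ if $$\int_{\mathbb{R}^n}u\,(-\Delta)^s\varphi\,dx-\int_\Omega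 u\,\mathrm{div}(\varphi\,\vec b)\,dx+\int_\Omega c\,u\,\varphi\,dx\le\int_\Omega f\varphi\,dx\qquad\text{for all }0\le\varphi\in C_0^\infty(\Omega).$$ Assume that $u,v\in\mathcal{L}_{2s}$ and $f,g\in L^1_{\rm loc}(\Omega)$ satisfy $$(-\Delta)^su+\vec b\cdot\nabla u+cu\le f\quad\text{and}\quad(-\Delta)^sv+\vec b\cdot\nabla v+cv\le g\qquad\text{in }\mathcal{D}'(\Omega).$$ Then $w=\max\{u,v\}$ belongs to $\mathcal{L}_{2s}$, the function $f\chi_{\{u>v\}}+g\chi_{\{u<v\}}+\max\{f,g\}\chi_{\{u=v\}}$ belongs to $L^1_{\rm loc}(\Omega)$, and $$(-\Delta)^sw+\vec b\cdot\nabla w+cw\le f\chi_{\{u>v\}}+g\chi_{\{u<v\}}+\max\{f,g\}\chi_{\{u=v\}}\qquad\text{in }\mathcal{D}'(\Omega).$$ -/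

import Mathlib

open MeasureTheory Filter Topology TopologicalSpace Set
open scoped Distributions ENNReal

noncomputable section

namespace FracMax

/-- The Euclidean space `ℝⁿ`. -/
abbrev Rn (n : ℕ) : Type := EuclideanSpace ℝ (Fin n)

/-- The normalizing constant
`C_{n,s} = 4^s s Γ(n/2 + s) / (π^{n/2} Γ(1 - s)) = 4^s Γ(n/2 + s) / (π^{n/2} |Γ(-s)|)`
of the fractional Laplacian. -/
def fracConst (n : ℕ) (s : ℝ) : ℝ :=
  (4 : ℝ) ^ s * s * Real.Gamma ((n : ℝ) / 2 + s) /
    (Real.pi ^ ((n : ℝ) / 2) * Real.Gamma (1 - s))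

/-- The truncated singular integral over `{y : |x - y| > ε}`. -/
def fracTrunc {n : ℕ} (s : ℝ) (φ : Rn n → ℝ) (x : Rn n) (ε : ℝ) : ℝ :=
  ∫ y in {y : Rn n | ε < ‖x - y‖}, (φ x - φ y) / ‖x - y‖ ^ ((n : ℝ) + 2 * s)

/-- The pointwise fractional Laplacian
`(-Δ)^s φ(x) = C_{n,s} P.V. ∫ (φ(x) - φ(y)) / |x - y|^{n+2s} dy`; it is only applied to
test functions, for which the limit defining the principal value exists. -/
def fracLaplacian {n : ℕ} (s : ℝ) (φ : Rn n → ℝ) (x : Rn n) : ℝ :=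
  fracConst n s * limUnder (𝓝[>] (0 : ℝ)) (fracTrunc s φ x)

/-- The class `𝓛_α` of (almost everywhere strongly measurable) functions `u : ℝⁿ → ℝ` with
`∫ |u(y)| / (1 + |y|^{n+α}) dy < ∞`. -/
def MemL {n : ℕ} (α : ℝ) (u : Rn n → ℝ) : Prop :=
  Integrable (fun y => u y / (1 + ‖y‖ ^ ((n : ℝ) + α))) volume

/-- The divergence `∑ i, ∂ᵢ Fᵢ` of a vector field. -/
def divergence {n : ℕ} (F : Rn n → Rn n) (x : Rn n) : ℝ :=
  ∑ i, fderiv ℝ F x (EuclideanSpace.single i 1) i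

/-- `‖b‖_{C¹(Ω)} < ∞`: `b` is continuously differentiable on the open set `Ω`, and `b` and its
derivative are bounded there. -/
def BoundedC1On {n : ℕ} (b : Rn n → Rn n) (Ω : Opens (Rn n)) : Prop :=
  ContDiffOn ℝ 1 b (Ω : Set (Rn n)) ∧
    ∃ M : ℝ, ∀ x ∈ Ω, ‖b x‖ ≤ M ∧ ‖fderiv ℝ b x‖ ≤ M

/-- The distribution `(-Δ)^s u` on `Ω`, evaluated at a test function:
`⟨(-Δ)^s u, φ⟩ = ∫_{ℝⁿ} u (-Δ)^s φ`. -/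
def fracLaplacianDistr {n : ℕ} {Ω : Opens (Rn n)} (s : ℝ) (u : Rn n → ℝ) (φ : 𝓓(Ω, ℝ)) : ℝ :=
  ∫ x, u x * fracLaplacian s φ x

/-- The distribution `b · ∇u` on `Ω`, evaluated at a test function:
`⟨b · ∇u, φ⟩ = - ∫_Ω u div(φ b)`. -/
def driftDistr {n : ℕ} {Ω : Opens (Rn n)} (b : Rn n → Rn n) (u : Rn n → ℝ) (φ : 𝓓(Ω, ℝ)) : ℝ :=
  - ∫ x in (Ω : Set (Rn n)), u x * divergence (fun y => φ y • b y) x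

/-- The distribution on `Ω` given by a locally integrable function, evaluated at a test function. -/
def funDistr {n : ℕ} {Ω : Opens (Rn n)} (f : Rn n → ℝ) (φ : 𝓓(Ω, ℝ)) : ℝ :=
  ∫ x in (Ω : Set (Rn n)), f x * φ x

/-- `(-Δ)^s u + b · ∇u + c u ≤ f` in `𝓓'(Ω)`: the inequality holds when tested against every
nonnegative test function. -/
def IsSubsolution {n : ℕ} (Ω : Opens (Rn n)) (s : ℝ) (b : Rn n → Rn n) (c : Rn n → ℝ)
    (u f : Rn n → ℝ) : Prop :=
  ∀ φ : 𝓓(Ω, ℝ), (∀ x, 0 ≤ φ x) →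
    fracLaplacianDistr s u φ + driftDistr b u φ + funDistr (fun x => c x * u x) φ ≤ funDistr f φ

/-- The function `f χ_{u>v} + g χ_{u<v} + max{f,g} χ_{u=v}`. -/
def maxRhs {n : ℕ} (u v f g : Rn n → ℝ) (x : Rn n) : ℝ :=
  {y | v y < u y}.indicator f x + {y | u y < v y}.indicator g x +
    {y | u y = v y}.indicator (fun y => max (f y) (g y)) x

end FracMax

end

/-!
Mollify with an even kernel `ρ` and put `U = ρ ⋆ u`, `V = ρ ⋆ v`. For a test function `φ ≥ 0`,
test the inequality for `u` with `ρ ⋆ (1_{V < U} φ)` and the one for `v` with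
`ρ ⋆ (1_{U ≤ V} φ)`; both are smooth, although the indicators are not.

* Nonlocal term. Where `V ≤ U`, replacing `U` by `max U V` can only decrease
  `∫ (U x - U y) / |x - y|^{n+2s} dy` over `|x - y| > ε`. Multiplying by `φ`, integrating and
  letting `ε → 0` shows that the two tests together dominate `∫ max U V (-Δ)^s φ`.
* Drift. Moving `ρ` from the test function to `u` leaves a commutator, which Friedrichs' lemma
  bounds by weighted integrals of `|u x - u y|` against a rescaled kernel. What remains is the chain
  rule for `max U V`.
* Right-hand sides. They become `f` where `V < U` and `g` where `U ≤ V`, up to an error that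
  vanishes as `ρ` concentrates. In the limit the choice is determined where `u ≠ v`, and is at most
  `max f g` where `u = v`.

All estimates are carried out against the weight `(1 + |x|^{n+2s})⁻¹`, which is stable under
convolution with kernels of the same decay. To make the drift globally defined it is cut off away
from the support of `φ`, and `c u`, `c v` are moved to the right-hand side.
-/

noncomputable section

namespace FracMax

open scoped Convolution

section Decay

variable {E : Type*} [NormedAddCommGroup E] {p : ℝ}

/-- The weight `1 / (1 + |x|^p)`; for `p = n + α` it is the one defining `𝓛_α`. -/
def weight (p : ℝ) (x : E) : ℝ := (1 + ‖x‖ ^ p)⁻¹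

lemma weight_pos (p : ℝ) (x : E) : 0 < weight p x := by
  unfold weight; positivity

lemma weight_le_one (p : ℝ) (x : E) : weight p x ≤ 1 :=
  inv_le_one_of_one_le₀ (le_add_of_nonneg_right (by positivity))

lemma weight_neg (p : ℝ) (x : E) : weight p (-x) = weight p x := by
  rw [weight, weight, norm_neg]

lemma continuous_weight (hp : 0 ≤ p) : Continuous (weight p : E → ℝ) :=
  (continuous_const.add (continuous_norm.rpow_const fun _ => .inr hp)).inv₀
    fun x => (by positivity : 0 < 1 + ‖x‖ ^ p).ne'

lemma add_rpow_le_two_rpow_mul {a b : ℝ} (ha : 0 ≤ a) (hb : 0 ≤ b) (hp : 0 ≤ p) :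
    (a + b) ^ p ≤ 2 ^ p * (a ^ p + b ^ p) := by
  wlog hab : a ≤ b generalizing a b
  · rw [add_comm, add_comm (a ^ p)]
    exact this hb ha (le_of_not_ge hab)
  calc (a + b) ^ p ≤ (2 * b) ^ p := by gcongr; linarith
    _ = 2 ^ p * b ^ p := Real.mul_rpow zero_le_two hb
    _ ≤ 2 ^ p * (a ^ p + b ^ p) := by gcongr; exact le_add_of_nonneg_left (by positivity)

lemma weight_sub_mul_weight_le (hp : 0 ≤ p) (x y : E) :
    weight p (x - y) * weight p y ≤ 2 ^ p * (weight p (x - y) + weight p y) * weight p x := by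
  have hxy : ‖x‖ ^ p ≤ 2 ^ p * (‖x - y‖ ^ p + ‖y‖ ^ p) :=
    (Real.rpow_le_rpow (norm_nonneg x) (by simpa using norm_add_le (x - y) y) hp).trans
      (add_rpow_le_two_rpow_mul (norm_nonneg _) (norm_nonneg _) hp)
  have h2 : 1 ≤ (2 : ℝ) ^ p := Real.one_le_rpow one_le_two hp
  have : 0 < 1 + ‖x - y‖ ^ p := by positivity
  have : 0 < 1 + ‖y‖ ^ p := by positivity
  have hc : 0 < 1 + ‖x‖ ^ p := by positivity
  have hsum : weight p (x - y) + weight p y =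
      ((1 + ‖x - y‖ ^ p) + (1 + ‖y‖ ^ p)) * (weight p (x - y) * weight p y) := by
    unfold weight; field_simp; ring
  rw [hsum, ← mul_assoc, mul_right_comm]
  refine le_mul_of_one_le_left (mul_pos (weight_pos _ _) (weight_pos _ _)).le ?_
  rw [weight, ← div_eq_mul_inv, one_le_div hc]
  linarith

lemma weight_sub_le (hp : 0 ≤ p) (x h : E) :
    weight p (x - h) ≤ 2 ^ p * (2 + ‖h‖ ^ p) * weight p x := by
  have hinv : weight p h * (1 + ‖h‖ ^ p) = 1 := inv_mul_cancel₀ (by positivity)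
  calc weight p (x - h) = weight p (x - h) * weight p h * (1 + ‖h‖ ^ p) := by
        rw [mul_assoc, hinv, mul_one]
    _ ≤ 2 ^ p * (weight p (x - h) + weight p h) * weight p x * (1 + ‖h‖ ^ p) := by
        gcongr ?_ * _; exact weight_sub_mul_weight_le hp x h
    _ = 2 ^ p * (weight p (x - h) * (1 + ‖h‖ ^ p) + weight p h * (1 + ‖h‖ ^ p)) * weight p x := by
        ring
    _ ≤ 2 ^ p * (1 * (1 + ‖h‖ ^ p) + 1) * weight p x := by
        have := (weight_pos p x).le
        rw [hinv]; gcongr; exact weight_le_one p _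
    _ = 2 ^ p * (2 + ‖h‖ ^ p) * weight p x := by ring

variable [MeasureSpace E]

/-- The kernels and test functions pairing with `𝓛_α`, `p = n + α`: measurable functions
dominated everywhere by a multiple of `weight p`. -/
structure IsDecaying (p : ℝ) (k : E → ℝ) : Prop where
  aestronglyMeasurable : AEStronglyMeasurable k
  exists_bound : ∃ C, ∀ x, |k x| ≤ C * weight p x

/-- The weighted Lebesgue space `L¹(weight p)`; for `p = n + α` this is `𝓛_α`. -/
def MemW (p : ℝ) (u : E → ℝ) : Prop := Integrable fun x => u x * weight p x

lemma IsDecaying.exists_nonneg_bound {k : E → ℝ} (hk : IsDecaying p k) :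
    ∃ C, 0 ≤ C ∧ ∀ x, |k x| ≤ C * weight p x := by
  obtain ⟨C, hC⟩ := hk.exists_bound
  exact ⟨C, nonneg_of_mul_nonneg_left ((abs_nonneg _).trans (hC 0)) (weight_pos p 0), hC⟩

lemma IsDecaying.abs {k : E → ℝ} (hk : IsDecaying p k) : IsDecaying p fun x => |k x| :=
  ⟨hk.1.norm, by simpa only [abs_abs] using hk.2⟩

lemma IsDecaying.sub {k l : E → ℝ} (hk : IsDecaying p k) (hl : IsDecaying p l) :
    IsDecaying p fun x => k x - l x := by
  obtain ⟨C, hC⟩ := hk.2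
  obtain ⟨D, hD⟩ := hl.2
  refine ⟨hk.1.sub hl.1, C + D, fun x => (abs_sub _ _).trans ?_⟩
  rw [add_mul]
  exact add_le_add (hC x) (hD x)

lemma IsDecaying.const_mul {k : E → ℝ} (hk : IsDecaying p k) (a : ℝ) :
    IsDecaying p fun x => a * k x := by
  obtain ⟨C, hC⟩ := hk.2
  refine ⟨hk.1.const_mul a, |a| * C, fun x => ?_⟩
  rw [abs_mul, mul_assoc]
  exact mul_le_mul_of_nonneg_left (hC x) (abs_nonneg a)

lemma IsDecaying.indicator {k : E → ℝ} (hk : IsDecaying p k) {S : Set E}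
    (hS : MeasurableSet S) : IsDecaying p (S.indicator k) := by
  obtain ⟨C, hC⟩ := hk.2
  exact ⟨hk.1.indicator hS, C, fun x => (norm_indicator_le_norm_self k x).trans (hC x)⟩

lemma IsDecaying.of_hasCompactSupport {k : E → ℝ} (hk : AEStronglyMeasurable k) {C : ℝ}
    (hC : ∀ x, |k x| ≤ C) (hkc : HasCompactSupport k) (hp : 0 ≤ p) : IsDecaying p k := by
  obtain ⟨R, hR⟩ := hkc.isBounded.exists_norm_le
  refine ⟨hk, C * (1 + |R| ^ p), fun x => ?_⟩
  have hC0 : 0 ≤ C := (abs_nonneg _).trans (hC x)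
  by_cases hx : x ∈ tsupport k
  · have hw : 1 ≤ (1 + |R| ^ p) * weight p x := by
      rw [weight, ← div_eq_mul_inv, one_le_div (by positivity)]
      gcongr
      exact (hR x hx).trans (le_abs_self R)
    calc |k x| ≤ C * 1 := by rw [mul_one]; exact hC x
      _ ≤ C * ((1 + |R| ^ p) * weight p x) := by gcongr
      _ = C * (1 + |R| ^ p) * weight p x := by ring
  · have := weight_pos p x
    rw [image_eq_zero_of_notMem_tsupport hx, abs_zero]
    positivity

lemma MemW.abs {u : E → ℝ} (hu : MemW p u) : MemW p fun x => |u x| := by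
  simpa only [MemW, norm_mul, Real.norm_eq_abs, abs_of_pos (weight_pos p _)] using hu.norm

lemma MemW.max {u v : E → ℝ} (hu : MemW p u) (hv : MemW p v) :
    MemW p fun x => max (u x) (v x) := by
  refine (hu.sup hv).congr (.of_forall fun x => ?_)
  exact (max_mul_of_nonneg _ _ (weight_pos p x).le).symm

variable [BorelSpace E]

lemma MemW.aestronglyMeasurable {u : E → ℝ} (hp : 0 ≤ p) (hu : MemW p u) :
    AEStronglyMeasurable u := by
  have hw : AEStronglyMeasurable (fun x : E => (weight p x)⁻¹) :=
    ((continuous_weight hp).inv₀ fun x => (weight_pos p x).ne').aestronglyMeasurable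
  exact (hu.1.mul hw).congr (.of_forall fun x => mul_inv_cancel_right₀ (weight_pos p x).ne' _)

lemma isDecaying_weight (hp : 0 ≤ p) : IsDecaying p (weight p : E → ℝ) :=
  ⟨(continuous_weight hp).aestronglyMeasurable, 1, fun x => by
    rw [abs_of_pos (weight_pos p x), one_mul]⟩

lemma MemW.mul_integrable {u k : E → ℝ} (hp : 0 ≤ p) (hu : MemW p u) (hk : IsDecaying p k) :
    Integrable fun x => u x * k x := by
  obtain ⟨C, hC⟩ := hk.2
  refine (hu.norm.const_mul C).mono' ((hu.aestronglyMeasurable hp).mul hk.1)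
    (.of_forall fun x => ?_)
  rw [norm_mul, norm_mul, Real.norm_of_nonneg (weight_pos p x).le, mul_left_comm]
  exact mul_le_mul_of_nonneg_left (hC x) (norm_nonneg _)

lemma MemW.of_integrable {u : E → ℝ} (hp : 0 ≤ p) (hu : Integrable u) : MemW p u :=
  hu.mul_bdd (c := 1) (continuous_weight hp).aestronglyMeasurable
    (.of_forall fun x => by rw [Real.norm_of_nonneg (weight_pos p x).le]; exact weight_le_one p x)

lemma IsDecaying.of_continuous {φ : E → ℝ} (hp : 0 ≤ p) (hφ : Continuous φ)
    (hφc : HasCompactSupport φ) : IsDecaying p φ := by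
  obtain ⟨A, hA⟩ := hφ.bounded_above_of_compact_support hφc
  exact .of_hasCompactSupport hφ.aestronglyMeasurable hA hφc hp

lemma MemW.locallyIntegrable [WeaklyLocallyCompactSpace E] {u : E → ℝ}
    (hp : 0 ≤ p) (hu : MemW p u) : LocallyIntegrable u := by
  rw [locallyIntegrable_iff]
  intro K hK
  have hw : ContinuousOn (fun x : E => (weight p x)⁻¹) K :=
    ((continuous_weight hp).inv₀ fun x => (weight_pos p x).ne').continuousOn
  exact (hu.integrableOn.mul_continuousOn hw hK).congr_fun
    (fun x _ => mul_inv_cancel_right₀ (weight_pos p x).ne' _) hK.measurableSet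

end Decay

section WeightedConvolution

variable {E : Type*} [NormedAddCommGroup E] [NormedSpace ℝ E] [FiniteDimensional ℝ E]
  [MeasureSpace E] [BorelSpace E] [(volume : Measure E).IsAddHaarMeasure] {p : ℝ}
  {k l u : E → ℝ}

lemma integrable_weight (hp : Module.finrank ℝ E < p) : Integrable (weight p : E → ℝ) := by
  have hp0 : 0 ≤ p := (Nat.cast_nonneg _).trans hp.le
  refine ((integrable_one_add_norm (E := E) (μ := volume) hp).const_mul (2 ^ p)).mono'
    (continuous_weight hp0).aestronglyMeasurable (.of_forall fun x => ?_)
  have := add_rpow_le_two_rpow_mul zero_le_one (norm_nonneg x) hp0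
  rw [Real.norm_of_nonneg (weight_pos p x).le, Real.rpow_neg (by positivity), weight,
    ← div_eq_mul_inv, inv_le_comm₀ (by positivity) (by positivity), inv_div,
    div_le_iff₀ (by positivity), mul_comm]
  simpa only [Real.one_rpow] using this

lemma IsDecaying.integrable (hp : Module.finrank ℝ E < p) (hk : IsDecaying p k) :
    Integrable k := by
  obtain ⟨C, hC⟩ := hk.exists_bound
  exact ((integrable_weight hp).const_mul C).mono' hk.1 (.of_forall hC)

lemma IsDecaying.memW (hp : Module.finrank ℝ E < p) (hk : IsDecaying p k) : MemW p k :=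
  .of_integrable ((Nat.cast_nonneg _).trans hp.le) (hk.integrable hp)

lemma IsDecaying.comp_sub_left (hp : 0 ≤ p) (hk : IsDecaying p k) (x : E) :
    IsDecaying p fun y => k (x - y) := by
  obtain ⟨C, hC0, hC⟩ := hk.exists_nonneg_bound
  refine ⟨hk.1.comp_quasiMeasurePreserving (quasiMeasurePreserving_sub_left volume x),
    C * (2 ^ p * (2 + ‖x‖ ^ p)), fun y => (hC _).trans ?_⟩
  rw [← neg_sub, weight_neg, mul_assoc]
  gcongr
  exact weight_sub_le hp y x

lemma integrable_prod_mul_sub_mul (hp : Module.finrank ℝ E < p) (hl : IsDecaying p l)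
    (hk : IsDecaying p k) (hu : MemW p u) :
    Integrable (fun z : E × E => l z.1 * (k (z.1 - z.2) * u z.2)) (volume.prod volume) := by
  have hp0 : 0 ≤ p := (Nat.cast_nonneg _).trans hp.le
  obtain ⟨C, hC0, hC⟩ := hk.exists_nonneg_bound
  obtain ⟨D, hD0, hD⟩ := hl.exists_nonneg_bound
  have hw := integrable_weight (E := E) hp
  have hsub : Integrable (fun z : E × E => weight p (z.1 - z.2) * ‖u z.2 * weight p z.2‖)
      (volume.prod volume) := by
    simpa only [ContinuousLinearMap.lsmul_apply, smul_eq_mul, mul_comm] using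
      hu.norm.convolution_integrand (ContinuousLinearMap.lsmul ℝ ℝ) hw
  refine ((hsub.add (hw.mul_prod hu.norm)).const_mul (D * C * 2 ^ p)).mono' ?_
    (.of_forall fun z => ?_)
  · have hum := hu.aestronglyMeasurable hp0
    have := hum.convolution_integrand (ContinuousLinearMap.lsmul ℝ ℝ) hk.1
    simp only [ContinuousLinearMap.lsmul_apply, smul_eq_mul] at this
    exact hl.1.comp_fst.mul (this.congr (.of_forall fun z => mul_comm _ _))
  · have hkey : weight p (z.1 - z.2) * weight p z.1 ≤
        2 ^ p * (weight p (z.1 - z.2) + weight p z.1) * weight p z.2 := by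
      rw [← weight_neg p (z.1 - z.2), neg_sub]
      exact weight_sub_mul_weight_le hp0 z.2 z.1
    simp only [norm_mul, Real.norm_of_nonneg (weight_pos p _).le, Pi.add_apply]
    calc ‖l z.1‖ * (‖k (z.1 - z.2)‖ * ‖u z.2‖)
        ≤ D * weight p z.1 * (C * weight p (z.1 - z.2) * ‖u z.2‖) := by
          have := (weight_pos p z.1).le
          gcongr
          exacts [hD _, hC _]
      _ = D * C * ‖u z.2‖ * (weight p (z.1 - z.2) * weight p z.1) := by ring
      _ ≤ D * C * ‖u z.2‖ *
          (2 ^ p * (weight p (z.1 - z.2) + weight p z.1) * weight p z.2) := by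
          gcongr
      _ = _ := by ring

lemma MemW.integrable_sub_mul (hp : 0 ≤ p) (hk : IsDecaying p k) (hu : MemW p u) (x : E) :
    Integrable fun y => k (x - y) * u y := by
  simpa only [mul_comm] using hu.mul_integrable hp (hk.comp_sub_left hp x)

lemma MemW.convolutionExistsAt (hp : 0 ≤ p) (hk : IsDecaying p k) (hu : MemW p u) (x : E) :
    ConvolutionExistsAt k u x (ContinuousLinearMap.lsmul ℝ ℝ) volume := by
  simpa only [ConvolutionExistsAt, ContinuousLinearMap.lsmul_apply, smul_eq_mul, sub_sub_cancel]
    using (hu.integrable_sub_mul hp hk x).comp_sub_left x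

lemma convolution_eq_integral_sub_mul (k u : E → ℝ) (x : E) :
    (k ⋆ u) x = ∫ y, k (x - y) * u y :=
  convolution_lsmul_swap

lemma MemW.convolution (hp : Module.finrank ℝ E < p) (hk : IsDecaying p k) (hu : MemW p u) :
    MemW p (k ⋆ u) := by
  have hp0 : 0 ≤ p := (Nat.cast_nonneg _).trans hp.le
  refine (integrable_prod_mul_sub_mul hp (isDecaying_weight hp0) hk hu).integral_prod_left.congr
    (.of_forall fun x => ?_)
  dsimp only
  rw [convolution_eq_integral_sub_mul, mul_comm, ← integral_const_mul]

lemma IsDecaying.convolution (hp : Module.finrank ℝ E < p) (hk : IsDecaying p k)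
    (hl : IsDecaying p l) : IsDecaying p (k ⋆ l) := by
  have hp0 : 0 ≤ p := (Nat.cast_nonneg _).trans hp.le
  obtain ⟨C, hC0, hC⟩ := hk.exists_nonneg_bound
  obtain ⟨D, hD0, hD⟩ := hl.exists_nonneg_bound
  have hw := integrable_weight (E := E) hp
  refine ⟨((hl.memW hp).convolution hp hk).aestronglyMeasurable hp0,
    2 ^ p * (2 * (∫ y : E, weight p y)) * (C * D), fun x => ?_⟩
  have hint : Integrable fun y : E => weight p (x - y) + weight p y :=
    (hw.comp_sub_left x).add hw
  rw [convolution_eq_integral_sub_mul, ← Real.norm_eq_abs]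
  calc ‖∫ y, k (x - y) * l y‖
      ≤ ∫ y, C * D * 2 ^ p * weight p x * (weight p (x - y) + weight p y) := by
        refine norm_integral_le_of_norm_le (hint.const_mul _) (.of_forall fun y => ?_)
        calc ‖k (x - y) * l y‖ ≤ (C * weight p (x - y)) * (D * weight p y) := by
              rw [norm_mul]
              have := (weight_pos p (x - y)).le
              exact mul_le_mul (hC _) (hD _) (norm_nonneg _) (by positivity)
          _ = C * D * (weight p (x - y) * weight p y) := by ring
          _ ≤ C * D * (2 ^ p * (weight p (x - y) + weight p y) * weight p x) := by
              gcongr C * D * ?_; exact weight_sub_mul_weight_le hp0 x y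
          _ = _ := by ring
    _ = _ := by
        rw [integral_const_mul, integral_add (hw.comp_sub_left x) hw,
          integral_sub_left_eq_self (weight p) volume x]
        ring

lemma integral_mul_convolution (hp : Module.finrank ℝ E < p) (hl : IsDecaying p l)
    (hk : IsDecaying p k) (hke : k.Even) (hu : MemW p u) :
    ∫ x, u x * (k ⋆ l) x = ∫ x, (k ⋆ u) x * l x := by
  have h := integrable_prod_mul_sub_mul hp hl hk hu
  calc ∫ x, u x * (k ⋆ l) x = ∫ y, ∫ x, l x * (k (x - y) * u y) := by
        congr 1 with y
        rw [convolution_eq_integral_sub_mul, ← integral_const_mul]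
        congr 1 with x
        rw [← hke, neg_sub]
        ring
    _ = ∫ x, ∫ y, l x * (k (x - y) * u y) := (integral_integral_swap h).symm
    _ = ∫ x, (k ⋆ u) x * l x := by
        congr 1 with x
        rw [convolution_eq_integral_sub_mul, mul_comm, ← integral_const_mul]

lemma MemW.convolution_left_comm (hp : Module.finrank ℝ E < p) (hk : IsDecaying p k)
    (hl : IsDecaying p l) (hu : MemW p u) : k ⋆ (l ⋆ u) = l ⋆ (k ⋆ u) := by
  have hp0 : 0 ≤ p := (Nat.cast_nonneg _).trans hp.le
  have hassoc {k l : E → ℝ} (hk : IsDecaying p k) (hl : IsDecaying p l) :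
      (k ⋆ l) ⋆ u = k ⋆ (l ⋆ u) := by
    ext x
    exact convolution_assoc (ContinuousLinearMap.lsmul ℝ ℝ) (ContinuousLinearMap.lsmul ℝ ℝ)
      (ContinuousLinearMap.lsmul ℝ ℝ) (ContinuousLinearMap.lsmul ℝ ℝ) (fun a b c => mul_assoc a b c)
      hk.1 hl.1 (hu.aestronglyMeasurable hp0)
      (.of_forall ((hl.memW hp).convolutionExistsAt hp0 hk))
      (.of_forall (MemW.convolutionExistsAt hp0 hl.abs hu.abs))
      ((hu.abs.convolution hp hl.abs).convolutionExistsAt hp0 hk.abs x)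
  have hcomm : k ⋆ l = l ⋆ k := by
    ext x
    rw [convolution_eq_integral_sub_mul, convolution_lsmul]
    simp only [smul_eq_mul, mul_comm]
  rw [← hassoc hk hl, ← hassoc hl hk, hcomm]

end WeightedConvolution

section JumpOperator

variable {E : Type*} [NormedAddCommGroup E] [NormedSpace ℝ E] [FiniteDimensional ℝ E]
  [MeasureSpace E] [BorelSpace E] [(volume : Measure E).IsAddHaarMeasure] {p : ℝ}
  {k l ρ u v : E → ℝ}

/-- The operator `u ↦ ∫ k (x - y) (u x - u y) dy` with integrable jump kernel `k`, in the form
`(∫ k) u - k ⋆ u`; for the truncated kernels `|h|^{-n-2s} 1_{|h| > η}` it is `fracTrunc`. -/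
def jumpOp (k u : E → ℝ) (x : E) : ℝ := (∫ y, k y) * u x - (k ⋆ u) x

lemma MemW.integrable_sub_mul_sub (hp : Module.finrank ℝ E < p) (hk : IsDecaying p k)
    (hu : MemW p u) (x : E) : Integrable fun y => k (x - y) * (u x - u y) := by
  simp only [mul_sub]
  exact (((hk.integrable hp).comp_sub_left x).mul_const _).sub
    (hu.integrable_sub_mul ((Nat.cast_nonneg _).trans hp.le) hk x)

lemma jumpOp_eq_integral (hp : Module.finrank ℝ E < p) (hk : IsDecaying p k) (hu : MemW p u)
    (x : E) : jumpOp k u x = ∫ y, k (x - y) * (u x - u y) := by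
  simp only [mul_sub]
  rw [integral_sub (((hk.integrable hp).comp_sub_left x).mul_const _)
      (hu.integrable_sub_mul ((Nat.cast_nonneg _).trans hp.le) hk x), integral_mul_const,
    integral_sub_left_eq_self k volume x, ← convolution_eq_integral_sub_mul, jumpOp]

lemma MemW.jumpOp (hp : Module.finrank ℝ E < p) (hk : IsDecaying p k) (hu : MemW p u) :
    MemW p (jumpOp k u) := by
  refine ((Integrable.const_mul hu (∫ y, k y)).sub (hu.convolution hp hk)).congr
    (.of_forall fun x => ?_)
  simp only [Pi.sub_apply, FracMax.jumpOp]
  ring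

lemma IsDecaying.jumpOp (hp : Module.finrank ℝ E < p) (hk : IsDecaying p k)
    (hl : IsDecaying p l) : IsDecaying p (jumpOp k l) :=
  (hl.const_mul _).sub (hk.convolution hp hl)

lemma integral_mul_jumpOp (hp : Module.finrank ℝ E < p) (hk : IsDecaying p k) (hke : k.Even)
    (hl : IsDecaying p l) (hu : MemW p u) :
    ∫ x, u x * jumpOp k l x = ∫ x, jumpOp k u x * l x := by
  have hp0 : 0 ≤ p := (Nat.cast_nonneg _).trans hp.le
  have hul := (hu.mul_integrable hp0 hl).const_mul (∫ y, k y)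
  simp only [jumpOp, mul_sub, sub_mul, mul_left_comm (u _), mul_assoc]
  rw [integral_sub hul (hu.mul_integrable hp0 (hk.convolution hp hl)),
    integral_sub hul ((hu.convolution hp hk).mul_integrable hp0 hl),
    integral_mul_convolution hp hl hk hke hu]

lemma jumpOp_convolution (hp : Module.finrank ℝ E < p) (hk : IsDecaying p k)
    (hρ : IsDecaying p ρ) (hu : MemW p u) : jumpOp k (ρ ⋆ u) = ρ ⋆ jumpOp k u := by
  have hp0 : 0 ≤ p := (Nat.cast_nonneg _).trans hp.le
  ext x
  rw [jumpOp, hu.convolution_left_comm hp hk hρ]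
  simp only [convolution_eq_integral_sub_mul ρ, jumpOp, mul_sub, mul_left_comm (ρ _)]
  rw [integral_sub ((hu.integrable_sub_mul hp0 hρ x).const_mul _)
    ((hu.convolution hp hk).integrable_sub_mul hp0 hρ x), integral_const_mul]

lemma integral_mul_jumpOp_convolution (hp : Module.finrank ℝ E < p) (hk : IsDecaying p k)
    (hke : k.Even) (hρ : IsDecaying p ρ) (hρe : ρ.Even) (hl : IsDecaying p l) (hu : MemW p u) :
    ∫ x, u x * jumpOp k (ρ ⋆ l) x = ∫ x, jumpOp k (ρ ⋆ u) x * l x := by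
  rw [integral_mul_jumpOp hp hk hke (hρ.convolution hp hl) hu,
    integral_mul_convolution hp hl hρ hρe (hu.jumpOp hp hk), jumpOp_convolution hp hk hρ hu]

/-- Kato's inequality: at a maximum of the two, `max u v` only has smaller increments. -/
lemma jumpOp_max_le_left (hp : Module.finrank ℝ E < p) (hk : IsDecaying p k) (hk0 : 0 ≤ k)
    (hu : MemW p u) (hv : MemW p v) {x : E} (hx : v x ≤ u x) :
    jumpOp k (fun y => max (u y) (v y)) x ≤ jumpOp k u x := by
  rw [jumpOp_eq_integral hp hk (hu.max hv), jumpOp_eq_integral hp hk hu]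
  refine integral_mono ((hu.max hv).integrable_sub_mul_sub hp hk x)
    (hu.integrable_sub_mul_sub hp hk x) fun y => ?_
  dsimp only
  rw [max_eq_left hx]
  exact mul_le_mul_of_nonneg_left (sub_le_sub_left (le_max_left _ _) _) (hk0 _)

lemma jumpOp_max_le_right (hp : Module.finrank ℝ E < p) (hk : IsDecaying p k) (hk0 : 0 ≤ k)
    (hu : MemW p u) (hv : MemW p v) {x : E} (hx : u x ≤ v x) :
    jumpOp k (fun y => max (u y) (v y)) x ≤ jumpOp k v x := by
  simpa only [max_comm] using jumpOp_max_le_left hp hk hk0 hv hu hx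

lemma integral_max_convolution_mul_jumpOp_le (hp : Module.finrank ℝ E < p) (hk : IsDecaying p k)
    (hke : k.Even) (hk0 : 0 ≤ k) (hρ : IsDecaying p ρ) (hρe : ρ.Even)
    (hu : MemW p u) (hv : MemW p v) {φ : E → ℝ} (hφ : IsDecaying p φ) (hφ0 : 0 ≤ φ)
    (h₁ : IsDecaying p ({y | (ρ ⋆ v) y < (ρ ⋆ u) y}.indicator φ))
    (h₂ : IsDecaying p ({y | (ρ ⋆ u) y ≤ (ρ ⋆ v) y}.indicator φ)) :
    ∫ x, max ((ρ ⋆ u) x) ((ρ ⋆ v) x) * jumpOp k φ x ≤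
      (∫ x, u x * jumpOp k (ρ ⋆ {y | (ρ ⋆ v) y < (ρ ⋆ u) y}.indicator φ) x) +
        ∫ x, v x * jumpOp k (ρ ⋆ {y | (ρ ⋆ u) y ≤ (ρ ⋆ v) y}.indicator φ) x := by
  have hp0 : 0 ≤ p := (Nat.cast_nonneg _).trans hp.le
  have hU := hu.convolution hp hρ
  have hV := hv.convolution hp hρ
  have hi₁ := (hU.jumpOp hp hk).mul_integrable hp0 h₁
  have hi₂ := (hV.jumpOp hp hk).mul_integrable hp0 h₂
  rw [integral_mul_jumpOp hp hk hke hφ (hU.max hV),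
    integral_mul_jumpOp_convolution hp hk hke hρ hρe h₁ hu,
    integral_mul_jumpOp_convolution hp hk hke hρ hρe h₂ hv, ← integral_add hi₁ hi₂]
  refine integral_mono (((hU.max hV).jumpOp hp hk).mul_integrable hp0 hφ) (hi₁.add hi₂) fun x => ?_
  rcases lt_or_ge ((ρ ⋆ v) x) ((ρ ⋆ u) x) with hx | hx
  · simpa [indicator, hx, hx.not_ge] using mul_le_mul_of_nonneg_right
      (jumpOp_max_le_left hp hk hk0 hU hV hx.le) (hφ0 x)
  · simpa [indicator, hx, hx.not_gt] using mul_le_mul_of_nonneg_right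
      (jumpOp_max_le_right hp hk hk0 hU hV hx) (hφ0 x)

end JumpOperator

section TruncatedKernel

variable {E : Type*} [NormedAddCommGroup E] {p η : ℝ}

/-- The kernel `|h|^{-p}` truncated to `{|h| > η}`. -/
def truncKernel (p η : ℝ) : E → ℝ := {h | η < ‖h‖}.indicator fun h => (‖h‖ ^ p)⁻¹

lemma truncKernel_of_lt {h : E} (hh : η < ‖h‖) : truncKernel p η h = (‖h‖ ^ p)⁻¹ :=
  indicator_of_mem (s := {h | η < ‖h‖}) hh _

lemma truncKernel_of_le {h : E} (hh : ‖h‖ ≤ η) : truncKernel p η h = 0 :=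
  indicator_of_notMem (s := {h | η < ‖h‖}) hh.not_gt _

lemma truncKernel_nonneg (p η : ℝ) : 0 ≤ (truncKernel p η : E → ℝ) :=
  fun h => indicator_nonneg (fun _ _ => by positivity) h

lemma truncKernel_le (p η : ℝ) (h : E) : truncKernel p η h ≤ (‖h‖ ^ p)⁻¹ :=
  indicator_le_self' (fun _ _ => by positivity) h

lemma even_truncKernel (p η : ℝ) : (truncKernel p η : E → ℝ).Even :=
  fun h => by simp only [truncKernel, indicator, mem_ofPred_eq, norm_neg]

lemma norm_truncKernel_mul_second_difference_le {φ : E → ℝ} {M : ℝ}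
    (hM : ∀ x h, |2 * φ x - φ (x + h) - φ (x - h)| ≤ M * min (‖h‖ ^ 2) 1) (p η : ℝ) (x h : E) :
    ‖truncKernel p η h * ((2 * φ x - φ (x + h) - φ (x - h)) / 2)‖ ≤
      (‖h‖ ^ p)⁻¹ * min (‖h‖ ^ 2) 1 * M := by
  rw [norm_mul, Real.norm_of_nonneg (truncKernel_nonneg p η h), Real.norm_eq_abs, abs_div, abs_two,
    mul_assoc]
  refine mul_le_mul (truncKernel_le p η h) ?_ (by positivity) (by positivity)
  linarith [hM x h, abs_nonneg (2 * φ x - φ (x + h) - φ (x - h))]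

variable [MeasureSpace E] [BorelSpace E]

lemma isDecaying_truncKernel (hp : 0 ≤ p) (hη : 0 < η) :
    IsDecaying p (truncKernel p η : E → ℝ) := by
  refine ⟨(((measurable_norm.pow_const p).inv).indicator
    (measurableSet_lt measurable_const measurable_norm)).aestronglyMeasurable,
    1 + (η ^ p)⁻¹, fun h => ?_⟩
  rw [abs_of_nonneg (truncKernel_nonneg p η h)]
  rcases lt_or_ge η ‖h‖ with hh | hh
  · have hh0 : 0 < ‖h‖ ^ p := Real.rpow_pos_of_pos (hη.trans hh) p
    have hηp : (‖h‖ ^ p)⁻¹ ≤ (η ^ p)⁻¹ := by gcongr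
    rw [truncKernel_of_lt hh, weight, ← div_eq_mul_inv, le_div_iff₀ (by positivity), mul_add,
      mul_one, inv_mul_cancel₀ hh0.ne']
    linarith
  · have := weight_pos p h
    rw [truncKernel_of_le hh]
    positivity

variable [NormedSpace ℝ E] [FiniteDimensional ℝ E] [(volume : Measure E).IsAddHaarMeasure]

lemma integrable_min_sq_mul_rpow_neg (hp : Module.finrank ℝ E < p)
    (hp2 : p < Module.finrank ℝ E + 2) :
    Integrable fun h : E => (‖h‖ ^ p)⁻¹ * min (‖h‖ ^ 2) 1 := by
  rcases subsingleton_or_nontrivial E with hE | hE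
  · simp [Subsingleton.elim _ (0 : E)]
  rw [integrable_fun_norm_addHaar volume (f := fun r : ℝ => (r ^ p)⁻¹ * min (r ^ 2) 1)]
  set d := Module.finrank ℝ E
  have hpow {r : ℝ} (hr : 0 < r) : r ^ (d - 1) * (r ^ p)⁻¹ = r ^ (d - 1 - p) := by
    rw [← Real.rpow_natCast, ← Real.rpow_neg hr.le, ← Real.rpow_add hr,
      Nat.cast_sub Module.finrank_pos, Nat.cast_one, sub_eq_add_neg _ p]
  rw [← Ioc_union_Ioi_eq_Ioi zero_le_one, integrableOn_union]
  constructor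
  · have hint : IntegrableOn (fun r : ℝ => r ^ (d + 1 - p)) (Ioc 0 1) :=
      (intervalIntegrable_iff_integrableOn_Ioc_of_le zero_le_one).1
        (intervalIntegral.intervalIntegrable_rpow' (by linarith))
    refine hint.congr_fun (fun r hr => ?_) measurableSet_Ioc
    have hmin : min (r ^ 2) 1 = r ^ 2 := min_eq_left (pow_le_one₀ hr.1.le hr.2)
    simp only [smul_eq_mul, hmin]
    rw [← mul_assoc, hpow hr.1, ← Real.rpow_natCast, ← Real.rpow_add hr.1]
    congr 1
    push_cast
    ring
  · have hint : IntegrableOn (fun r : ℝ => r ^ (d - 1 - p)) (Ioi 1) :=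
      integrableOn_Ioi_rpow_of_lt (by linarith) zero_lt_one
    refine hint.congr_fun (fun r hr => ?_) measurableSet_Ioi
    have hmin : min (r ^ 2) 1 = 1 := min_eq_right (one_le_pow₀ (le_of_lt hr))
    simp only [smul_eq_mul, hmin, mul_one]
    exact (hpow (zero_lt_one.trans hr)).symm

lemma jumpOp_eq_integral_second_difference {k φ : E → ℝ} (hp : Module.finrank ℝ E < p)
    (hk : IsDecaying p k) (hke : k.Even) (hφ : MemW p φ) (x : E) :
    jumpOp k φ x = ∫ h, k h * ((2 * φ x - φ (x + h) - φ (x - h)) / 2) := by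
  have hsub : Integrable fun h => k h * (φ x - φ (x - h)) := by
    simpa only [sub_sub_cancel] using (hφ.integrable_sub_mul_sub hp hk x).comp_sub_left x
  have hadd : Integrable fun h => k h * (φ x - φ (x + h)) := by
    simpa only [hke _, sub_neg_eq_add] using hsub.comp_neg
  have hjump_sub : jumpOp k φ x = ∫ h, k h * (φ x - φ (x - h)) := by
    rw [jumpOp_eq_integral hp hk hφ, ← integral_sub_left_eq_self _ volume x]
    simp only [sub_sub_cancel]
  have hjump_add : jumpOp k φ x = ∫ h, k h * (φ x - φ (x + h)) := by
    rw [hjump_sub, ← integral_neg_eq_self]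
    simp only [hke _, sub_neg_eq_add]
  calc jumpOp k φ x = (jumpOp k φ x + jumpOp k φ x) / 2 := by ring
    _ = ∫ h, (k h * (φ x - φ (x - h)) + k h * (φ x - φ (x + h))) / 2 := by
        rw [integral_div, integral_add hsub hadd, ← hjump_sub, ← hjump_add]
    _ = _ := by congr 1 with h; ring

end TruncatedKernel

section SecondDifference

variable {E : Type*} [NormedAddCommGroup E] [NormedSpace ℝ E] {φ : E → ℝ}

lemma abs_second_difference_le_of_lipschitzWith_fderiv {L : NNReal} (hφ : Differentiable ℝ φ)
    (hL : LipschitzWith L (fderiv ℝ φ)) (x h : E) :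
    |2 * φ x - φ (x + h) - φ (x - h)| ≤ 2 * L * ‖h‖ ^ 2 := by
  have key := (convex_closedBall (0 : E) ‖h‖).norm_image_sub_le_of_norm_hasFDerivWithin_le
    (f := fun k => φ (x + k) + φ (x - k)) (f' := fun k => fderiv ℝ φ (x + k) - fderiv ℝ φ (x - k))
    (C := 2 * L * ‖h‖) (x := h) (y := 0) ?_ ?_ (by simp) (by simp)
  · simp only [add_zero, sub_zero, Real.norm_eq_abs, zero_sub, norm_neg] at key
    calc _ = |φ x + φ x - (φ (x + h) + φ (x - h))| := by congr 1; ring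
      _ ≤ _ := key
      _ = _ := by ring
  · intro k _
    have hadd : HasFDerivAt (fun k => φ (x + k)) (fderiv ℝ φ (x + k)) k :=
      (hasFDerivAt_comp_add_left x).2 (hφ _).hasFDerivAt
    have hsub : HasFDerivAt (fun k => φ (x - k)) (-fderiv ℝ φ (x - k)) k := by
      have := (hφ (x - k)).hasFDerivAt.comp k ((hasFDerivAt_id k).const_sub x)
      rwa [ContinuousLinearMap.comp_neg, ContinuousLinearMap.comp_id] at this
    rw [sub_eq_add_neg]
    exact (hadd.add hsub).hasFDerivWithinAt
  · intro k hk
    rw [mem_closedBall_zero_iff] at hk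
    calc ‖fderiv ℝ φ (x + k) - fderiv ℝ φ (x - k)‖ ≤ L * ‖x + k - (x - k)‖ := by
          simpa only [dist_eq_norm] using hL.dist_le_mul (x + k) (x - k)
      _ = L * (2 * ‖k‖) := by
          rw [show x + k - (x - k) = (2 : ℝ) • k by rw [two_smul]; abel, norm_smul, Real.norm_two]
      _ ≤ L * (2 * ‖h‖) := by gcongr
      _ = 2 * L * ‖h‖ := by ring

lemma exists_second_difference_bound (hφ : ContDiff ℝ 2 φ) (hφc : HasCompactSupport φ) :
    ∃ M, 0 ≤ M ∧ ∀ x h, |2 * φ x - φ (x + h) - φ (x - h)| ≤ M * min (‖h‖ ^ 2) 1 := by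
  obtain ⟨A, hA⟩ := hφ.continuous.bounded_above_of_compact_support hφc
  obtain ⟨L, hL⟩ := (hφ.fderiv_right (m := 1) (by norm_num)).lipschitzWith_of_hasCompactSupport
    (hφc.fderiv ℝ) one_ne_zero
  have hA0 : 0 ≤ A := (norm_nonneg _).trans (hA 0)
  have : (0 : ℝ) ≤ L := L.2
  refine ⟨4 * A + 2 * L, by positivity, fun x h => ?_⟩
  rcases min_choice (‖h‖ ^ 2) 1 with e | e <;> rw [e]
  · have hquad := abs_second_difference_le_of_lipschitzWith_fderiv
      (hφ.differentiable two_ne_zero) hL x h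
    nlinarith [sq_nonneg ‖h‖]
  · have h₁ := abs_le.1 (hA x)
    have h₂ := abs_le.1 (hA (x + h))
    have h₃ := abs_le.1 (hA (x - h))
    rw [abs_le]
    constructor <;> linarith [h₁.1, h₁.2, h₂.1, h₂.2, h₃.1, h₃.2]

end SecondDifference

section PrincipalValue

variable {E : Type*} [NormedAddCommGroup E] [NormedSpace ℝ E] [FiniteDimensional ℝ E]
  [MeasureSpace E] [BorelSpace E] [(volume : Measure E).IsAddHaarMeasure] {p : ℝ} {φ : E → ℝ}

lemma tendsto_jumpOp_truncKernel (hp : Module.finrank ℝ E < p)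
    (hp2 : p < Module.finrank ℝ E + 2) (hφ : ContDiff ℝ 2 φ) (hφc : HasCompactSupport φ) (x : E) :
    Tendsto (fun η => jumpOp (truncKernel p η) φ x) (𝓝[>] 0)
      (𝓝 (∫ h, (‖h‖ ^ p)⁻¹ * ((2 * φ x - φ (x + h) - φ (x - h)) / 2))) := by
  have hp0 : 0 ≤ p := (Nat.cast_nonneg _).trans hp.le
  obtain ⟨M, -, hM⟩ := exists_second_difference_bound hφ hφc
  have hcont := hφ.continuous
  have hφd := IsDecaying.of_continuous hp0 hcont hφc
  have hev : ∀ᶠ η in 𝓝[>] (0 : ℝ),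
      (∫ h, truncKernel p η h * ((2 * φ x - φ (x + h) - φ (x - h)) / 2)) =
        jumpOp (truncKernel p η) φ x :=
    eventually_mem_nhdsWithin.mono fun η hη => (jumpOp_eq_integral_second_difference hp
      (isDecaying_truncKernel hp0 hη) (even_truncKernel p η) (hφd.memW hp) x).symm
  refine Tendsto.congr' hev ?_
  refine tendsto_integral_filter_of_dominated_convergence _
    (eventually_mem_nhdsWithin.mono fun η hη => ?_) (.of_forall fun η => .of_forall
      (norm_truncKernel_mul_second_difference_le hM p η x))
    ((integrable_min_sq_mul_rpow_neg hp hp2).mul_const M) (.of_forall fun h => ?_)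
  · exact (isDecaying_truncKernel hp0 hη).1.mul
      (Continuous.aestronglyMeasurable (by fun_prop))
  · rcases eq_or_ne h 0 with rfl | hh
    · have : 2 * φ x - φ (x + 0) - φ (x - 0) = 0 := by rw [add_zero, sub_zero]; ring
      simp only [this, zero_div, mul_zero, tendsto_const_nhds]
    · refine tendsto_const_nhds.congr' ?_
      have : ∀ᶠ η in 𝓝[>] (0 : ℝ), η < ‖h‖ :=
        (eventually_lt_nhds (norm_pos_iff.2 hh)).filter_mono nhdsWithin_le_nhds
      filter_upwards [this] with η hη
      rw [truncKernel_of_lt hη]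

lemma exists_jumpOp_truncKernel_sub_bound (hp : Module.finrank ℝ E < p)
    (hp2 : p < Module.finrank ℝ E + 2) (hφ : ContDiff ℝ 2 φ) (hφc : HasCompactSupport φ) :
    ∃ C, 0 ≤ C ∧ ∀ η ∈ Ioc (0 : ℝ) 1, ∀ x,
      |jumpOp (truncKernel p η) φ x - jumpOp (truncKernel p 1) φ x| ≤
        (Metric.cthickening 1 (tsupport φ)).indicator (fun _ => C) x := by
  have hp0 : 0 ≤ p := (Nat.cast_nonneg _).trans hp.le
  obtain ⟨M, hM0, hM⟩ := exists_second_difference_bound hφ hφc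
  have hI := integrable_min_sq_mul_rpow_neg hp hp2
  have hφd := IsDecaying.of_continuous hp0 hφ.continuous hφc
  refine ⟨(∫ h : E, (‖h‖ ^ p)⁻¹ * min (‖h‖ ^ 2) 1) * M,
    mul_nonneg (integral_nonneg fun h => by positivity) hM0, fun η hη x => ?_⟩
  have hjump {ε : ℝ} (hε : 0 < ε) := jumpOp_eq_integral_second_difference hp
    (isDecaying_truncKernel hp0 hε) (even_truncKernel p ε) (hφd.memW hp) x
  have hint {ε : ℝ} (hε : 0 < ε) :
      Integrable fun h => truncKernel p ε h * ((2 * φ x - φ (x + h) - φ (x - h)) / 2) :=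
    (hI.mul_const M).mono' ((isDecaying_truncKernel hp0 hε).1.mul
      (Continuous.aestronglyMeasurable (by have := hφ.continuous; fun_prop)))
      (.of_forall (norm_truncKernel_mul_second_difference_le hM p ε x))
  have hterm (h : E) : ‖truncKernel p η h * ((2 * φ x - φ (x + h) - φ (x - h)) / 2) -
      truncKernel p 1 h * ((2 * φ x - φ (x + h) - φ (x - h)) / 2)‖ ≤
      (Metric.cthickening 1 (tsupport φ)).indicator
        (fun _ => (‖h‖ ^ p)⁻¹ * min (‖h‖ ^ 2) 1 * M) x := by
    rcases lt_or_ge 1 ‖h‖ with hh | hh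
    · rw [truncKernel_of_lt hh, truncKernel_of_lt (hη.2.trans_lt hh), sub_self, norm_zero]
      exact indicator_nonneg (fun _ _ => by positivity) x
    rw [truncKernel_of_le hh, zero_mul, sub_zero]
    by_cases hx : x ∈ Metric.cthickening 1 (tsupport φ)
    · rw [indicator_of_mem hx]
      exact norm_truncKernel_mul_second_difference_le hM p η x h
    · have hφ0 (y : E) (hy : dist x y ≤ 1) : φ y = 0 := image_eq_zero_of_notMem_tsupport
        fun hyφ => hx (Metric.mem_cthickening_of_dist_le x y 1 _ hyφ hy)
      rw [indicator_of_notMem hx, hφ0 x (by simp), hφ0 (x + h) (by simpa), hφ0 (x - h) (by simpa)]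
      simp
  rw [hjump hη.1, hjump one_pos, ← integral_sub (hint hη.1) (hint one_pos), ← Real.norm_eq_abs]
  by_cases hx : x ∈ Metric.cthickening 1 (tsupport φ)
  · simp only [indicator_of_mem hx] at hterm ⊢
    rw [← integral_mul_const]
    exact norm_integral_le_of_norm_le (hI.mul_const M) (.of_forall hterm)
  · simp only [indicator_of_notMem hx] at hterm ⊢
    simpa using norm_integral_le_of_norm_le (integrable_zero E ℝ volume) (.of_forall hterm)

lemma exists_isDecaying_jumpOp_truncKernel_le (hp : Module.finrank ℝ E < p)
    (hp2 : p < Module.finrank ℝ E + 2) (hφ : ContDiff ℝ 2 φ) (hφc : HasCompactSupport φ) :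
    ∃ d : E → ℝ, IsDecaying p d ∧
      ∀ η ∈ Ioc (0 : ℝ) 1, ∀ x, |jumpOp (truncKernel p η) φ x| ≤ d x := by
  have hp0 : 0 ≤ p := (Nat.cast_nonneg _).trans hp.le
  obtain ⟨C, hC0, hC⟩ := exists_jumpOp_truncKernel_sub_bound hp hp2 hφ hφc
  have hT := (isDecaying_truncKernel hp0 one_pos).jumpOp hp
    (IsDecaying.of_continuous hp0 hφ.continuous hφc)
  have hind : IsDecaying p ((Metric.cthickening 1 (tsupport φ)).indicator fun _ => -C) :=
    .of_hasCompactSupport (measurable_const.indicator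
        Metric.isClosed_cthickening.measurableSet).aestronglyMeasurable (C := C)
      (fun x => (norm_indicator_le_norm_self (fun _ => -C) x).trans_eq
        (by rw [norm_neg, Real.norm_of_nonneg hC0]))
      (.intro hφc.cthickening fun x hx => indicator_of_notMem hx _) hp0
  refine ⟨_, hT.abs.sub hind, fun η hη x => ?_⟩
  rw [indicator_neg, sub_neg_eq_add, ← sub_le_iff_le_add']
  exact (abs_sub_abs_le_abs_sub _ _).trans (hC η hη x)

end PrincipalValue

section FractionalLaplacian

variable {n : ℕ} {s : ℝ}

lemma memL_iff_memW {u : Rn n → ℝ} : MemL (2 * s) u ↔ MemW (n + 2 * s) u := by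
  simp only [MemL, MemW, weight, div_eq_mul_inv]

lemma fracConst_nonneg (hs0 : 0 < s) (hs1 : s < 1) : 0 ≤ fracConst n s := by
  have : 0 < Real.Gamma ((n : ℝ) / 2 + s) := Real.Gamma_pos_of_pos (by positivity)
  have : 0 < Real.Gamma (1 - s) := Real.Gamma_pos_of_pos (by linarith)
  unfold fracConst
  positivity

lemma finrank_lt_add_two_mul (hs0 : 0 < s) : Module.finrank ℝ (Rn n) < n + 2 * s := by
  rw [finrank_euclideanSpace_fin]
  linarith

lemma add_two_mul_lt_finrank_add_two (hs1 : s < 1) :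
    n + 2 * s < Module.finrank ℝ (Rn n) + 2 := by
  rw [finrank_euclideanSpace_fin]
  linarith

lemma fracTrunc_eq_jumpOp (hs0 : 0 < s) {η : ℝ} (hη : 0 < η) {u : Rn n → ℝ}
    (hu : MemW (n + 2 * s) u) (x : Rn n) :
    fracTrunc s u x η = jumpOp (truncKernel (n + 2 * s) η) u x := by
  rw [jumpOp_eq_integral (finrank_lt_add_two_mul hs0)
    (isDecaying_truncKernel (by positivity) hη) hu, fracTrunc, ← integral_indicator
    (measurableSet_lt measurable_const (by fun_prop))]
  congr 1 with y
  by_cases hy : η < ‖x - y‖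
  · rw [indicator_of_mem (by exact hy), truncKernel_of_lt hy, div_eq_inv_mul]
  · rw [indicator_of_notMem (by exact hy), truncKernel_of_le (not_lt.1 hy), zero_mul]

variable {φ u v : Rn n → ℝ}

lemma tendsto_jumpOp_fracLaplacian (hs0 : 0 < s) (hs1 : s < 1) (hφ : ContDiff ℝ 2 φ)
    (hφc : HasCompactSupport φ) (x : Rn n) :
    Tendsto (fun η => fracConst n s * jumpOp (truncKernel (n + 2 * s) η) φ x) (𝓝[>] 0)
      (𝓝 (fracLaplacian s φ x)) := by
  have hp := finrank_lt_add_two_mul (n := n) hs0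
  have hjump := tendsto_jumpOp_truncKernel hp (add_two_mul_lt_finrank_add_two hs1) hφ hφc x
  have htrunc : Tendsto (fracTrunc s φ x) (𝓝[>] 0) _ := hjump.congr' <|
    eventually_mem_nhdsWithin.mono fun η hη => (fracTrunc_eq_jumpOp hs0 hη
      ((IsDecaying.of_continuous (by positivity) hφ.continuous hφc).memW hp) x).symm
  rw [fracLaplacian, htrunc.limUnder_eq]
  exact hjump.const_mul _

lemma isDecaying_fracLaplacian (hs0 : 0 < s) (hs1 : s < 1) (hφ : ContDiff ℝ 2 φ)
    (hφc : HasCompactSupport φ) : IsDecaying (n + 2 * s) (fracLaplacian s φ) := by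
  have hp := finrank_lt_add_two_mul (n := n) hs0
  have hp0 : 0 ≤ n + 2 * s := by positivity
  have hφd := IsDecaying.of_continuous hp0 hφ.continuous hφc
  obtain ⟨d, hd, hdle⟩ := exists_isDecaying_jumpOp_truncKernel_le hp
    (add_two_mul_lt_finrank_add_two hs1) hφ hφc
  have hlim := tendsto_jumpOp_fracLaplacian hs0 hs1 hφ hφc
  have hseq : Tendsto (fun k : ℕ => 1 / ((k : ℝ) + 1)) atTop (𝓝[>] 0) :=
    tendsto_nhdsWithin_iff.2 ⟨tendsto_one_div_add_atTop_nhds_zero_nat,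
      .of_forall fun k => mem_Ioi.2 Nat.one_div_pos_of_nat⟩
  obtain ⟨C, hC⟩ := (hd.const_mul (fracConst n s)).exists_bound
  refine ⟨aestronglyMeasurable_of_tendsto_ae atTop (fun k => ?_)
    (.of_forall fun x => (hlim x).comp hseq), C, fun x => (?_ : _ ≤ _).trans (hC x)⟩
  · exact (((isDecaying_truncKernel hp0 Nat.one_div_pos_of_nat).jumpOp hp hφd).const_mul _).1
  · refine le_of_tendsto (hlim x).abs (eventually_of_mem (Ioc_mem_nhdsGT one_pos) fun η hη => ?_)
    rw [abs_mul, abs_mul]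
    exact mul_le_mul_of_nonneg_left ((hdle η hη x).trans (le_abs_self _)) (abs_nonneg _)

lemma tendsto_integral_mul_jumpOp (hs0 : 0 < s) (hs1 : s < 1) (hφ : ContDiff ℝ 2 φ)
    (hφc : HasCompactSupport φ) (hu : MemW (n + 2 * s) u) :
    Tendsto (fun η => fracConst n s * ∫ x, u x * jumpOp (truncKernel (n + 2 * s) η) φ x) (𝓝[>] 0)
      (𝓝 (∫ x, u x * fracLaplacian s φ x)) := by
  have hp := finrank_lt_add_two_mul (n := n) hs0
  have hp0 : 0 ≤ n + 2 * s := by positivity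
  have hφd := IsDecaying.of_continuous hp0 hφ.continuous hφc
  obtain ⟨d, hd, hdle⟩ := exists_isDecaying_jumpOp_truncKernel_le hp
    (add_two_mul_lt_finrank_add_two hs1) hφ hφc
  simp only [← integral_const_mul, mul_left_comm (fracConst n s)]
  refine tendsto_integral_filter_of_dominated_convergence
    (fun x => ‖u x * (fracConst n s * d x)‖) (eventually_mem_nhdsWithin.mono fun η hη => ?_)
    (eventually_of_mem (Ioc_mem_nhdsGT one_pos) fun η hη => .of_forall fun x => ?_)
    (hu.mul_integrable hp0 (hd.const_mul _)).norm
    (.of_forall fun x => (tendsto_jumpOp_fracLaplacian hs0 hs1 hφ hφc x).const_mul (u x))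
  · exact (hu.mul_integrable hp0
      (((isDecaying_truncKernel hp0 hη).jumpOp hp hφd).const_mul _)).1
  · simp only [norm_mul]
    gcongr
    exact (hdle η hη x).trans (le_abs_self _)

lemma integral_max_convolution_mul_fracLaplacian_le (hs0 : 0 < s) (hs1 : s < 1) {ρ : Rn n → ℝ}
    (hρ : ContDiff ℝ 2 ρ) (hρc : HasCompactSupport ρ) (hρe : ρ.Even)
    (hu : MemW (n + 2 * s) u) (hv : MemW (n + 2 * s) v)
    (hφ : ContDiff ℝ 2 φ) (hφc : HasCompactSupport φ) (hφ0 : 0 ≤ φ) :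
    ∫ x, max ((ρ ⋆ u) x) ((ρ ⋆ v) x) * fracLaplacian s φ x ≤
      (∫ x, u x * fracLaplacian s (ρ ⋆ {y | (ρ ⋆ v) y < (ρ ⋆ u) y}.indicator φ) x) +
        ∫ x, v x * fracLaplacian s (ρ ⋆ {y | (ρ ⋆ u) y ≤ (ρ ⋆ v) y}.indicator φ) x := by
  have hp := finrank_lt_add_two_mul (n := n) hs0
  have hp0 : 0 ≤ n + 2 * s := by positivity
  have hρd := IsDecaying.of_continuous hp0 hρ.continuous hρc
  have hφd := IsDecaying.of_continuous hp0 hφ.continuous hφc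
  have hcont {q : Rn n → ℝ} (hq : MemW (n + 2 * s) q) : Continuous (ρ ⋆ q) :=
    hρc.continuous_convolution_left _ hρ.continuous (hq.locallyIntegrable hp0)
  have h₁ := hφd.indicator
    (measurableSet_lt (hcont hv).measurable (hcont hu).measurable)
  have h₂ := hφd.indicator
    (measurableSet_le (hcont hu).measurable (hcont hv).measurable)
  have hsupp (S : Set (Rn n)) : HasCompactSupport (S.indicator φ) :=
    hφc.mono (support_indicator.trans_subset inter_subset_right)
  have hlim {q w : Rn n → ℝ} (hq : MemW (n + 2 * s) q) (hqc : HasCompactSupport q)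
      (hw : MemW (n + 2 * s) w) := tendsto_integral_mul_jumpOp hs0 hs1
    (hρc.contDiff_convolution_left _ hρ (hq.locallyIntegrable hp0))
    (hρc.convolution (ContinuousLinearMap.lsmul ℝ ℝ) hqc) hw
  refine le_of_tendsto_of_tendsto (tendsto_integral_mul_jumpOp hs0 hs1 hφ hφc
      ((hu.convolution hp hρd).max (hv.convolution hp hρd)))
    ((hlim (h₁.memW hp) (hsupp _) hu).add
      (hlim (h₂.memW hp) (hsupp _) hv))
    (eventually_mem_nhdsWithin.mono fun η hη => ?_)
  dsimp only
  rw [← mul_add]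
  exact mul_le_mul_of_nonneg_left (integral_max_convolution_mul_jumpOp_le hp
    (isDecaying_truncKernel hp0 hη) (even_truncKernel _ η) (truncKernel_nonneg _ η) hρd hρe hu hv
    hφd hφ0 h₁ h₂) (fracConst_nonneg hs0 hs1)

end FractionalLaplacian

section Translation

variable {E : Type*} [NormedAddCommGroup E] [MeasureSpace E] [BorelSpace E] {p : ℝ}
  {u : E → ℝ}

lemma tendsto_integral_abs_mul_weight_add_sub (hp : 0 ≤ p) (hu : MemW p u) :
    Tendsto (fun h => ∫ x, |u x * (weight p (x + h) - weight p x)|) (𝓝 0) (𝓝 0) := by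
  have hw := continuous_weight (E := E) hp
  have hlim : Tendsto (fun h => ∫ x, |u x * (weight p (x + h) - weight p x)|) (𝓝 0)
      (𝓝 (∫ _ : E, (0 : ℝ))) := by
    refine tendsto_integral_filter_of_dominated_convergence
      (fun x => (2 ^ p * (2 + 1 ^ p) + 1) * ‖u x * weight p x‖)
      (.of_forall fun h => ?_) ?_ (hu.norm.const_mul _) (.of_forall fun x => ?_)
    · exact ((hu.aestronglyMeasurable hp).mul
        (Continuous.aestronglyMeasurable (by fun_prop))).norm
    · filter_upwards [Metric.closedBall_mem_nhds 0 one_pos] with h hh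
      refine .of_forall fun x => ?_
      have hxh := weight_sub_le hp x (-h)
      rw [sub_neg_eq_add, norm_neg] at hxh
      have hpos := weight_pos p x
      rw [Real.norm_eq_abs, abs_abs, abs_mul, norm_mul, mul_left_comm, Real.norm_of_nonneg hpos.le]
      refine mul_le_mul_of_nonneg_left ?_ (abs_nonneg _)
      calc |weight p (x + h) - weight p x| ≤ |weight p (x + h)| + |weight p x| := abs_sub _ _
        _ = weight p (x + h) + weight p x := by
          rw [abs_of_pos hpos, abs_of_pos (weight_pos p _)]
        _ ≤ 2 ^ p * (2 + 1 ^ p) * weight p x + weight p x := by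
          gcongr
          refine hxh.trans ?_
          gcongr
          exact mem_closedBall_zero_iff.1 hh
        _ = (2 ^ p * (2 + 1 ^ p) + 1) * weight p x := by ring
    · have : Continuous fun h => |u x * (weight p (x + h) - weight p x)| := by fun_prop
      simpa using this.tendsto 0
  simpa only [integral_zero] using hlim

variable [(volume : Measure E).IsAddRightInvariant]

lemma MemW.comp_sub_right (hp : 0 ≤ p) (hu : MemW p u) (h : E) : MemW p fun x => u (x - h) := by
  refine ((Integrable.comp_sub_right hu h).norm.const_mul (2 ^ p * (2 + ‖h‖ ^ p))).mono'
    (((hu.aestronglyMeasurable hp).comp_quasiMeasurePreserving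
      (measurePreserving_sub_right volume h).quasiMeasurePreserving).mul
        (continuous_weight hp).aestronglyMeasurable) (.of_forall fun x => ?_)
  have hw := weight_sub_le hp (x - h) (-h)
  rw [sub_neg_eq_add, sub_add_cancel, norm_neg] at hw
  rw [norm_mul, norm_mul, Real.norm_of_nonneg (weight_pos p _).le,
    Real.norm_of_nonneg (weight_pos p _).le, mul_left_comm]
  exact mul_le_mul_of_nonneg_left hw (norm_nonneg _)

/-- The modulus of continuity `h ↦ ‖u(· - h) - u‖` of translations in `L¹(weight p)`. -/
def translationModulus (p : ℝ) (u : E → ℝ) (h : E) : ℝ := ∫ x, |u (x - h) - u x| * weight p x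

lemma MemW.integrable_translationModulus (hp : 0 ≤ p) (hu : MemW p u) (h : E) :
    Integrable fun x => |u (x - h) - u x| * weight p x :=
  MemW.abs <| ((hu.comp_sub_right hp h).sub hu).congr
    (.of_forall fun _ => (sub_mul _ _ _).symm)

end Translation

section Oscillation

variable {E : Type*} [NormedAddCommGroup E] [NormedSpace ℝ E] [FiniteDimensional ℝ E]
  [MeasureSpace E] [BorelSpace E] [(volume : Measure E).IsAddHaarMeasure] {p : ℝ}
  {K u : E → ℝ}

open DomAddAct in
lemma tendsto_integral_abs_sub_right_sub (hu : Integrable u) :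
    Tendsto (fun h => ∫ x, |u (x - h) - u x|) (𝓝 0) (𝓝 0) := by
  have hu1 := memLp_one_iff_integrable.2 hu
  have : Fact ((1 : ℝ≥0∞) ≠ ∞) := ⟨ENNReal.one_ne_top⟩
  have : Continuous (mk : E → Eᵈᵃᵃ) := continuous_mk
  have hcont : Continuous fun h : E => ‖(mk (-h) +ᵥ hu1.toLp u) - hu1.toLp u‖ := by
    fun_prop
  have hnorm (h : E) : ‖(mk (-h) +ᵥ hu1.toLp u) - hu1.toLp u‖ = ∫ x, |u (x - h) - u x| := by
    have hsub := (hu1.comp_measurePreserving (measurePreserving_vadd (-h) volume)).sub hu1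
    rw [mk_vadd_toLp (M := E), ← MemLp.toLp_sub, L1.norm_eq_integral_norm]
    refine integral_congr_ae (hsub.coeFn_toLp.mono fun x hx => ?_)
    refine (congrArg norm hx).trans ?_
    rw [Pi.sub_apply, Function.comp_apply, vadd_eq_add, neg_add_eq_sub, Real.norm_eq_abs]
  have := hcont.tendsto 0
  rw [hnorm 0] at this
  simpa only [hnorm, sub_zero, sub_self, abs_zero, integral_zero] using this

lemma MemW.tendsto_translationModulus (hp : 0 ≤ p) (hu : MemW p u) :
    Tendsto (translationModulus p u) (𝓝 0) (𝓝 0) := by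
  have hlim := (tendsto_integral_abs_sub_right_sub hu).add
    (tendsto_integral_abs_mul_weight_add_sub hp hu)
  rw [add_zero] at hlim
  refine squeeze_zero (fun h => integral_nonneg fun x =>
    mul_nonneg (abs_nonneg _) (weight_pos p x).le) (fun h => ?_) hlim
  have hi₁ : Integrable fun x => |u (x - h) * weight p (x - h) - u x * weight p x| :=
    ((Integrable.comp_sub_right hu h).sub hu).abs
  have hi₂ : Integrable fun x => |u x * (weight p (x + h) - weight p x)| := by
    refine Integrable.abs ((Integrable.sub ?_ hu).congr (.of_forall fun _ => (mul_sub _ _ _).symm))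
    simpa only [add_sub_cancel_right] using
      Integrable.comp_add_right (hu.comp_sub_right hp h) h
  rw [← integral_sub_right_eq_self (fun x => |u x * (weight p (x + h) - weight p x)|) h,
    ← integral_add hi₁ (hi₂.comp_sub_right h)]
  refine integral_mono (hu.integrable_translationModulus hp h)
    (hi₁.add (hi₂.comp_sub_right h)) fun x => ?_
  calc |u (x - h) - u x| * weight p x = |(u (x - h) * weight p (x - h) - u x * weight p x) +
        u (x - h) * (weight p (x - h + h) - weight p (x - h))| := by
        rw [sub_add_cancel, ← abs_of_pos (weight_pos p x), ← abs_mul, abs_of_pos (weight_pos p x)]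
        congr 1
        ring
    _ ≤ _ := abs_add_le _ _

/-- The mean oscillation of `u` around `x`, weighted by `K`; it measures both `K ⋆ u - u`
(when `∫ K = 1`) and the commutator of a mollification with a transport operator. -/
def oscillation (K u : E → ℝ) (x : E) : ℝ := ∫ y, K (x - y) * |u x - u y|

lemma MemW.integrable_oscillation (hp : Module.finrank ℝ E < p) (hK : IsDecaying p K)
    (hu : MemW p u) (x : E) : Integrable fun y => K (x - y) * |u x - u y| := by
  refine (hu.integrable_sub_mul_sub hp hK x).mono (((hK.comp_sub_left
    ((Nat.cast_nonneg _).trans hp.le) x).1).mul ?_) (.of_forall fun y => ?_)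
  · exact (aestronglyMeasurable_const.sub
      (hu.aestronglyMeasurable ((Nat.cast_nonneg _).trans hp.le))).norm
  · simp only [norm_mul, Real.norm_eq_abs, abs_abs, le_refl]

lemma oscillation_mul_weight (K u : E → ℝ) (x : E) :
    oscillation K u x * weight p x = ∫ h, K h * (|u (x - h) - u x| * weight p x) := by
  rw [oscillation, ← integral_mul_const, ← integral_sub_left_eq_self _ volume x]
  simp only [sub_sub_cancel, abs_sub_comm, mul_assoc]

lemma MemW.integrable_prod_oscillation (hp : Module.finrank ℝ E < p) (hK : IsDecaying p K)
    (hK0 : 0 ≤ K) (hu : MemW p u) :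
    Integrable (fun z : E × E => K z.2 * (|u (z.1 - z.2) - u z.1| * weight p z.1))
      (volume.prod volume) := by
  have hp0 : 0 ≤ p := (Nat.cast_nonneg _).trans hp.le
  have hshear : MeasurePreserving (fun z : E × E => (z.1, z.1 - z.2)) (volume.prod volume)
      (volume.prod volume) := by
    simpa only [Function.comp_def, Prod.map, id, sub_eq_add_neg] using
      (measurePreserving_prod_add volume volume).comp
        ((MeasurePreserving.id (volume : Measure E)).prod (Measure.measurePreserving_neg volume))
  have hsub := (hshear.integrable_comp_of_integrable (integrable_prod_mul_sub_mul hp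
    (isDecaying_weight hp0) hK hu)).sub (hu.mul_prod (hK.integrable hp))
  refine hsub.abs.congr (.of_forall fun z => ?_)
  have hfactor : weight p z.1 * (K (z.1 - (z.1 - z.2)) * u (z.1 - z.2)) -
      u z.1 * weight p z.1 * K z.2 = K z.2 * ((u (z.1 - z.2) - u z.1) * weight p z.1) := by
    rw [sub_sub_cancel]
    ring
  dsimp only [Pi.sub_apply, Function.comp_apply]
  rw [hfactor, abs_mul, abs_mul, abs_of_nonneg (hK0 z.2), abs_of_pos (weight_pos p z.1)]

lemma MemW.oscillation (hp : Module.finrank ℝ E < p) (hK : IsDecaying p K) (hK0 : 0 ≤ K)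
    (hu : MemW p u) : MemW p (oscillation K u) := by
  simp only [MemW, oscillation_mul_weight]
  exact (hu.integrable_prod_oscillation hp hK hK0).integral_prod_left

lemma integral_oscillation_mul_weight_le (hp : Module.finrank ℝ E < p) (hK : IsDecaying p K)
    (hK0 : 0 ≤ K) (hu : MemW p u) {δ : ℝ} (hδ : ∀ h, K h ≠ 0 → translationModulus p u h ≤ δ) :
    ∫ x, FracMax.oscillation K u x * weight p x ≤ δ * ∫ h, K h := by
  have hint := hu.integrable_prod_oscillation hp hK hK0
  have hmod (h : E) : ∫ x, K h * (|u (x - h) - u x| * weight p x) =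
      K h * translationModulus p u h := integral_const_mul _ _
  simp only [oscillation_mul_weight]
  rw [integral_integral_swap hint, mul_comm δ, ← integral_mul_const]
  refine integral_mono hint.integral_prod_right ((hK.integrable hp).mul_const δ) fun h => ?_
  dsimp only
  rw [hmod]
  rcases eq_or_ne (K h) 0 with h0 | h0
  · rw [h0, zero_mul, zero_mul]
  · exact mul_le_mul_of_nonneg_left (hδ h h0) (hK0 h)

lemma tendsto_integral_oscillation_mul_weight (hp : Module.finrank ℝ E < p) {ι : Type*}
    {l : Filter ι} {K : ι → E → ℝ} {C : ℝ} (hK : ∀ i, IsDecaying p (K i)) (hK0 : ∀ i, 0 ≤ K i)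
    (hC : ∀ i, ∫ x, K i x ≤ C)
    (hsupp : Tendsto (fun i => Function.support (K i)) l (𝓝 0).smallSets) (hu : MemW p u) :
    Tendsto (fun i => ∫ x, FracMax.oscillation (K i) u x * weight p x) l (𝓝 0) := by
  have hosc0 (i : ι) : 0 ≤ ∫ x, FracMax.oscillation (K i) u x * weight p x :=
    integral_nonneg fun x => mul_nonneg
      (integral_nonneg fun y => mul_nonneg (hK0 i _) (abs_nonneg _)) (weight_pos p x).le
  refine tendsto_order.2 ⟨fun a ha => .of_forall fun i => ha.trans_le (hosc0 i), fun a ha => ?_⟩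
  have hδ : 0 < a / (|C| + 1) := by positivity
  have hmod := (hu.tendsto_translationModulus ((Nat.cast_nonneg _).trans hp.le)).eventually
    (eventually_le_nhds hδ)
  filter_upwards [hsupp.eventually (eventually_smallSets_forall.2 hmod)] with i hi
  calc ∫ x, FracMax.oscillation (K i) u x * weight p x ≤ a / (|C| + 1) * ∫ h, K i h :=
        integral_oscillation_mul_weight_le hp (hK i) (hK0 i) hu hi
    _ ≤ a / (|C| + 1) * |C| := by
        gcongr
        exact (hC i).trans (le_abs_self C)
    _ < a / (|C| + 1) * (|C| + 1) := by
        gcongr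
        exact lt_add_one _
    _ = a := div_mul_cancel₀ _ (by positivity)

lemma abs_convolution_sub_le (hp : Module.finrank ℝ E < p) {ρ : E → ℝ} (hρ : IsDecaying p ρ)
    (hρ0 : 0 ≤ ρ) (hρ1 : ∫ x, ρ x = 1) (hu : MemW p u) (x : E) :
    |(ρ ⋆ u) x - u x| ≤ FracMax.oscillation ρ u x := by
  have h := jumpOp_eq_integral hp hρ hu x
  rw [jumpOp, hρ1, one_mul] at h
  rw [abs_sub_comm, h, ← Real.norm_eq_abs]
  refine norm_integral_le_of_norm_le (hu.integrable_oscillation hp hρ x) (.of_forall fun y => ?_)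
  rw [norm_mul, Real.norm_of_nonneg (hρ0 _), Real.norm_eq_abs]

end Oscillation

section Mollifier

variable {E : Type*} [NormedAddCommGroup E]

/-- The bump functions defining the mollifiers, of one shape up to dilation. -/
def mollifierBump (E : Type*) [NormedAddCommGroup E] (k : ℕ) : ContDiffBump (0 : E) where
  rIn := (2 * ((k : ℝ) + 1))⁻¹
  rOut := ((k : ℝ) + 1)⁻¹
  rIn_pos := by positivity
  rIn_lt_rOut := inv_strictAnti₀ (by positivity) (by linarith [(k.cast_nonneg : (0 : ℝ) ≤ k)])

lemma tendsto_mollifierBump_rOut : Tendsto (fun k => (mollifierBump E k).rOut) atTop (𝓝 0) := by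
  simpa only [one_div, mollifierBump] using tendsto_one_div_add_atTop_nhds_zero_nat (𝕜 := ℝ)

variable [NormedSpace ℝ E]

/-- The kernel whose oscillations control the commutator of `ρ ⋆ ·` with a vector field. -/
def commutatorKernel (ρ : E → ℝ) (x : E) : ℝ := |ρ x| + ‖x‖ * ‖fderiv ℝ ρ x‖

lemma commutatorKernel_nonneg (ρ : E → ℝ) : 0 ≤ commutatorKernel ρ := fun x => by
  dsimp only [Pi.zero_apply, commutatorKernel]; positivity

lemma continuous_commutatorKernel {ρ : E → ℝ} (hρ : ContDiff ℝ 1 ρ) :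
    Continuous (commutatorKernel ρ) := by
  have := hρ.continuous_fderiv one_ne_zero
  have := hρ.continuous
  unfold commutatorKernel
  fun_prop

lemma support_commutatorKernel_subset (ρ : E → ℝ) :
    Function.support (commutatorKernel ρ) ⊆ tsupport ρ := by
  refine Function.support_subset_iff'.2 fun x hx => ?_
  rw [commutatorKernel, image_eq_zero_of_notMem_tsupport hx,
    fderiv_of_notMem_tsupport ℝ hx, norm_zero, mul_zero, abs_zero, add_zero]

lemma isDecaying_commutatorKernel [MeasureSpace E] [BorelSpace E] {p : ℝ} {ρ : E → ℝ}
    (hp : 0 ≤ p) (hρ : ContDiff ℝ 1 ρ) (hρc : HasCompactSupport ρ) :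
    IsDecaying p (commutatorKernel ρ) :=
  .of_continuous hp (continuous_commutatorKernel hρ)
    (hρc.mono' (support_commutatorKernel_subset ρ))

variable [FiniteDimensional ℝ E]

lemma mollifierBump_apply (k : ℕ) (x : E) :
    mollifierBump E k x = mollifierBump E 0 (((k : ℝ) + 1) • x) := by
  have hratio (k : ℕ) : ((k : ℝ) + 1)⁻¹ / (2 * ((k : ℝ) + 1))⁻¹ = 2 := by field_simp
  simp only [ContDiffBump.apply, mollifierBump, hratio, sub_zero, smul_smul, inv_inv]
  simp

variable [MeasureSpace E]

/-- An even approximate identity of smooth functions, indexed by `k → ∞`. -/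
def mollifier (k : ℕ) : E → ℝ := (mollifierBump E k).normed volume

lemma contDiff_mollifier (k : ℕ) {m : ℕ∞} : ContDiff ℝ m (mollifier k : E → ℝ) :=
  (mollifierBump E k).contDiff_normed

lemma even_mollifier (k : ℕ) : (mollifier k : E → ℝ).Even :=
  (mollifierBump E k).normed_neg

lemma mollifier_nonneg (k : ℕ) : 0 ≤ (mollifier k : E → ℝ) :=
  (mollifierBump E k).nonneg_normed

variable [BorelSpace E] [(volume : Measure E).IsAddHaarMeasure]

lemma hasCompactSupport_mollifier (k : ℕ) : HasCompactSupport (mollifier k : E → ℝ) :=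
  (mollifierBump E k).hasCompactSupport_normed

lemma integral_mollifier (k : ℕ) : ∫ x : E, mollifier k x = 1 :=
  (mollifierBump E k).integral_normed

lemma tsupport_mollifier (k : ℕ) :
    tsupport (mollifier k : E → ℝ) = Metric.closedBall 0 ((k : ℝ) + 1)⁻¹ :=
  (mollifierBump E k).tsupport_normed_eq

lemma ae_tendsto_mollifier_convolution {u : E → ℝ} (hu : LocallyIntegrable u) :
    ∀ᵐ x, Tendsto (fun k => (mollifier k ⋆ u) x) atTop (𝓝 (u x)) :=
  ContDiffBump.ae_convolution_tendsto_right_of_locallyIntegrable (K := 2)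
    tendsto_mollifierBump_rOut (.of_forall fun k => by
      simp only [mollifierBump, mul_inv]; linarith) hu

lemma continuous_mollifier_convolution (k : ℕ) {u : E → ℝ} (hu : LocallyIntegrable u) :
    Continuous (mollifier k ⋆ u) :=
  (hasCompactSupport_mollifier k).continuous_convolution_left _
    (contDiff_mollifier k (m := 0)).continuous hu

lemma mollifier_apply (k : ℕ) (x : E) : mollifier k x =
    ((k : ℝ) + 1) ^ Module.finrank ℝ E * mollifier 0 (((k : ℝ) + 1) • x) := by
  simp only [mollifier, ContDiffBump.normed_def, mollifierBump_apply k]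
  rw [Measure.integral_comp_smul_of_nonneg _ _ _ (hR := by positivity), smul_eq_mul]
  field_simp

lemma integral_commutatorKernel_mollifier (k : ℕ) :
    ∫ x : E, commutatorKernel (mollifier k) x = ∫ x : E, commutatorKernel (mollifier 0) x := by
  have hk : (0 : ℝ) < k + 1 := by positivity
  have hscale (x : E) : commutatorKernel (mollifier k) x = ((k : ℝ) + 1) ^ Module.finrank ℝ E *
      commutatorKernel (mollifier 0) (((k : ℝ) + 1) • x) := by
    have hρ : (mollifier k : E → ℝ) = fun x => ((k : ℝ) + 1) ^ Module.finrank ℝ E *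
      mollifier 0 (((k : ℝ) + 1) • x) := funext (mollifier_apply k)
    have hd : DifferentiableAt ℝ (fun x : E => mollifier 0 (((k : ℝ) + 1) • x)) x :=
      ((contDiff_mollifier (m := 1) 0).differentiable one_ne_zero).differentiableAt.comp x
        (differentiableAt_id.const_smul _)
    rw [commutatorKernel, commutatorKernel, hρ, fderiv_const_mul hd, fderiv_comp_smul]
    simp only [abs_mul, norm_smul, abs_of_pos (pow_pos hk _), Real.norm_of_nonneg hk.le,
      Real.norm_of_nonneg (pow_pos hk _).le]
    ring
  simp only [hscale]
  rw [integral_const_mul, Measure.integral_comp_smul_of_nonneg _ _ _ (hR := hk.le), smul_eq_mul,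
    mul_inv_cancel_left₀ (by positivity)]

/-- The weighted mean oscillation of `u` at the scale of `ρ`. It controls both the distance of
`ρ ⋆ u` to `u` in `L¹(weight p)` and the Friedrichs commutator of `ρ ⋆ ·` with a Lipschitz drift. -/
def mollificationDefect (p : ℝ) (ρ u : E → ℝ) : ℝ :=
  ∫ x, oscillation (commutatorKernel ρ) u x * weight p x

lemma tendsto_mollificationDefect {p : ℝ} (hp : Module.finrank ℝ E < p)
    {u : E → ℝ} (hu : MemW p u) :
    Tendsto (fun k => mollificationDefect p (mollifier k) u) atTop (𝓝 0) := by
  refine tendsto_integral_oscillation_mul_weight hp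
    (fun k => isDecaying_commutatorKernel ((Nat.cast_nonneg _).trans hp.le)
      (contDiff_mollifier k) (hasCompactSupport_mollifier k))
    (fun k => commutatorKernel_nonneg _) (fun k => (integral_commutatorKernel_mollifier k).le) ?_ hu
  refine Metric.nhds_basis_closedBall.smallSets.tendsto_right_iff.2 fun r hr => ?_
  filter_upwards [tendsto_mollifierBump_rOut (E := E) |>.eventually_le_const hr] with k hk
  exact (support_commutatorKernel_subset _).trans
    ((tsupport_mollifier k).trans_subset (Metric.closedBall_subset_closedBall hk))

end Mollifier

section Divergence

variable {n : ℕ} {F : Rn n → Rn n} {z : Rn n → ℝ}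

lemma sum_apply_single_mul (L : Rn n →L[ℝ] ℝ) (v : Rn n) :
    ∑ i, L (EuclideanSpace.single i 1) * v i = L v := by
  conv_rhs => rw [← (EuclideanSpace.basisFun (Fin n) ℝ).sum_repr v, map_sum]
  exact Finset.sum_congr rfl fun i _ => by
    rw [map_smul, smul_eq_mul, mul_comm, EuclideanSpace.basisFun_repr,
      EuclideanSpace.basisFun_apply]

lemma divergence_smul {ψ : Rn n → ℝ} {x : Rn n} (hψ : DifferentiableAt ℝ ψ x)
    (hF : DifferentiableAt ℝ F x) :
    divergence (fun y => ψ y • F y) x = ψ x * divergence F x + fderiv ℝ ψ x (F x) := by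
  rw [divergence, fderiv_fun_smul hψ hF, divergence, ← sum_apply_single_mul (fderiv ℝ ψ x) (F x),
    Finset.mul_sum, ← Finset.sum_add_distrib]
  rfl

lemma divergence_sub_const (F : Rn n → Rn n) (v x : Rn n) :
    divergence (fun y => F y - v) x = divergence F x := by
  simp only [divergence, fderiv_sub_const]

lemma divergence_of_notMem_tsupport {x : Rn n} (hx : x ∉ tsupport F) : divergence F x = 0 := by
  rw [divergence, fderiv_of_notMem_tsupport ℝ hx]
  exact Finset.sum_eq_zero fun _ _ => rfl

lemma continuous_divergence (hF : ContDiff ℝ 1 F) : Continuous (divergence F) := by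
  have := hF.continuous_fderiv one_ne_zero
  unfold divergence
  fun_prop

lemma hasCompactSupport_divergence (hFc : HasCompactSupport F) :
    HasCompactSupport (divergence F) :=
  .intro' hFc.isCompact (isClosed_tsupport F) fun _ => divergence_of_notMem_tsupport

lemma integrable_mul_divergence (hF : ContDiff ℝ 1 F) (hFc : HasCompactSupport F)
    (hz : Continuous z) : Integrable fun x => z x * divergence F x :=
  (hz.mul (continuous_divergence hF)).integrable_of_hasCompactSupport
    (hasCompactSupport_divergence hFc).mul_left

lemma integrable_fderiv_apply (hF : Continuous F) (hFc : HasCompactSupport F)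
    (hz : ContDiff ℝ 1 z) : Integrable fun x => fderiv ℝ z x (F x) :=
  ((hz.continuous_fderiv one_ne_zero).clm_apply hF).integrable_of_hasCompactSupport
    (.intro' hFc.isCompact (isClosed_tsupport F) fun x hx => by
      rw [image_eq_zero_of_notMem_tsupport hx, map_zero])

lemma integral_mul_divergence (hF : ContDiff ℝ 1 F) (hFc : HasCompactSupport F)
    (hz : ContDiff ℝ 1 z) : ∫ x, z x * divergence F x = -∫ x, fderiv ℝ z x (F x) := by
  have hFi (i : Fin n) : ContDiff ℝ 1 fun x => F x i :=
    (EuclideanSpace.proj i : Rn n →L[ℝ] ℝ).contDiff.comp hF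
  have hFic (i : Fin n) : HasCompactSupport fun x => F x i :=
    hFc.comp_left (g := fun v : Rn n => v i) rfl
  have hdiv (x : Rn n) (i : Fin n) : fderiv ℝ (fun y => F y i) x (EuclideanSpace.single i 1) =
      fderiv ℝ F x (EuclideanSpace.single i 1) i := by
    exact congrArg (· (EuclideanSpace.single i (1 : ℝ)))
      ((EuclideanSpace.proj i : Rn n →L[ℝ] ℝ).hasFDerivAt.comp x
        (hF.differentiable one_ne_zero x).hasFDerivAt).fderiv
  have hi₁ (i : Fin n) : Integrable
      (fun x => z x * fderiv ℝ (fun y => F y i) x (EuclideanSpace.single i 1)) :=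
    (hz.continuous.mul (((hFi i).continuous_fderiv one_ne_zero).clm_apply
      continuous_const)).integrable_of_hasCompactSupport ((hFic i).fderiv_apply ℝ _).mul_left
  have hi₂ (i : Fin n) : Integrable
      (fun x => fderiv ℝ z x (EuclideanSpace.single i 1) * F x i) :=
    (((hz.continuous_fderiv one_ne_zero).clm_apply continuous_const).mul
      (hFi i).continuous).integrable_of_hasCompactSupport (hFic i).mul_left
  have hi₃ (i : Fin n) : Integrable (fun x => z x * F x i) :=
    (hz.continuous.mul (hFi i).continuous).integrable_of_hasCompactSupport (hFic i).mul_left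
  calc ∫ x, z x * divergence F x
      = ∑ i, ∫ x, z x * fderiv ℝ (fun y => F y i) x (EuclideanSpace.single i 1) := by
        simp only [divergence, ← hdiv, Finset.mul_sum]
        exact integral_finsetSum _ fun i _ => hi₁ i
    _ = -∑ i, ∫ x, fderiv ℝ z x (EuclideanSpace.single i 1) * F x i := by
        rw [← Finset.sum_neg_distrib]
        exact Finset.sum_congr rfl fun i _ =>
          integral_mul_fderiv_eq_neg_fderiv_mul_of_integrable (hi₂ i) (hi₁ i) (hi₃ i)
            (fun x _ => hz.differentiable one_ne_zero x)
            (fun x _ => (hFi i).differentiable one_ne_zero x)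
    _ = -∫ x, fderiv ℝ z x (F x) := by
        rw [← integral_finsetSum _ fun i _ => hi₂ i]
        simp only [sum_apply_single_mul]

lemma integral_divergence (hF : ContDiff ℝ 1 F) (hFc : HasCompactSupport F) :
    ∫ x, divergence F x = 0 := by
  simpa using integral_mul_divergence hF hFc (z := fun _ => 1) contDiff_const

lemma integral_comp_mul_divergence (hF : ContDiff ℝ 1 F) (hFc : HasCompactSupport F)
    (hz : ContDiff ℝ 1 z) {h : ℝ → ℝ} (hh : ContDiff ℝ 1 h) :
    ∫ x, h (z x) * divergence F x = -∫ x, deriv h (z x) * fderiv ℝ z x (F x) := by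
  have hchain (x : Rn n) : fderiv ℝ (h ∘ z) x = deriv h (z x) • fderiv ℝ z x :=
    ((hh.differentiable one_ne_zero _).hasDerivAt.comp_hasFDerivAt x
      (hz.differentiable one_ne_zero x).hasFDerivAt).fderiv
  have hparts := integral_mul_divergence hF hFc (hh.comp hz)
  simp only [hchain] at hparts
  exact hparts

/-- A smooth function vanishing on `(-∞, 0]` and equal to the identity on `[1, ∞)`; its rescalings
`t ↦ smoothRamp (k * t) / k` approximate the positive part together with its derivative. -/
def smoothRamp (t : ℝ) : ℝ := t * Real.smoothTransition t

lemma contDiff_smoothRamp : ContDiff ℝ 1 smoothRamp :=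
  contDiff_id.mul Real.smoothTransition.contDiff

lemma smoothRamp_of_nonpos {t : ℝ} (ht : t ≤ 0) : smoothRamp t = 0 := by
  rw [smoothRamp, Real.smoothTransition.zero_of_nonpos ht, mul_zero]

lemma smoothRamp_of_one_le {t : ℝ} (ht : 1 ≤ t) : smoothRamp t = t := by
  rw [smoothRamp, Real.smoothTransition.one_of_one_le ht, mul_one]

lemma abs_smoothRamp_le (t : ℝ) : |smoothRamp t| ≤ |t| := by
  rw [smoothRamp, abs_mul, abs_of_nonneg (Real.smoothTransition.nonneg t)]
  exact mul_le_of_le_one_right (abs_nonneg t) (Real.smoothTransition.le_one t)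

lemma deriv_smoothRamp_of_nonpos {t : ℝ} (ht : t ≤ 0) : deriv smoothRamp t = 0 := by
  refine IsLocalMin.deriv_eq_zero (.of_forall fun r => ?_)
  rw [smoothRamp_of_nonpos ht]
  rcases le_total r 0 with hr | hr
  · rw [smoothRamp_of_nonpos hr]
  · exact mul_nonneg hr (Real.smoothTransition.nonneg r)

lemma deriv_smoothRamp_of_one_lt {t : ℝ} (ht : 1 < t) : deriv smoothRamp t = 1 := by
  have hid : smoothRamp =ᶠ[𝓝 t] id :=
    (eventually_gt_nhds ht).mono fun r hr => smoothRamp_of_one_le hr.le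
  rw [hid.deriv_eq, deriv_id]

lemma exists_abs_deriv_smoothRamp_le : ∃ C, ∀ t, |deriv smoothRamp t| ≤ C := by
  obtain ⟨C, hC⟩ := isCompact_Icc.exists_bound_of_continuousOn (s := Icc 0 1)
    (contDiff_smoothRamp.continuous_deriv le_rfl).continuousOn
  refine ⟨max C 1, fun t => ?_⟩
  rcases le_or_gt t 0 with h0 | h0
  · rw [deriv_smoothRamp_of_nonpos h0, abs_zero]
    exact zero_le_one.trans (le_max_right _ _)
  rcases le_or_gt t 1 with h1 | h1
  · exact (hC t ⟨h0.le, h1⟩).trans (le_max_left _ _)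
  · rw [deriv_smoothRamp_of_one_lt h1, abs_one]
    exact le_max_right _ _

lemma eventually_one_lt_add_one_mul {t : ℝ} (ht : 0 < t) :
    ∀ᶠ k : ℕ in atTop, 1 < ((k : ℝ) + 1) * t :=
  ((tendsto_natCast_atTop_atTop.atTop_add tendsto_const_nhds).atTop_mul_const
    ht).eventually_gt_atTop 1

lemma tendsto_smoothRamp_mul_div (t : ℝ) :
    Tendsto (fun k : ℕ => smoothRamp (((k : ℝ) + 1) * t) / ((k : ℝ) + 1)) atTop
      (𝓝 (max t 0)) := by
  refine tendsto_const_nhds.congr' ?_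
  rcases le_or_gt t 0 with ht | ht
  · refine .of_forall fun k => ?_
    dsimp only
    rw [smoothRamp_of_nonpos (mul_nonpos_of_nonneg_of_nonpos (by positivity) ht), max_eq_right ht,
      zero_div]
  · filter_upwards [eventually_one_lt_add_one_mul ht] with k hk
    rw [smoothRamp_of_one_le hk.le, max_eq_left ht.le, mul_div_cancel_left₀ _ (by positivity)]

lemma tendsto_deriv_smoothRamp_mul (t : ℝ) :
    Tendsto (fun k : ℕ => deriv smoothRamp (((k : ℝ) + 1) * t)) atTop
      (𝓝 ((Ioi 0).indicator 1 t)) := by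
  refine tendsto_const_nhds.congr' ?_
  rcases le_or_gt t 0 with ht | ht
  · refine .of_forall fun k => ?_
    dsimp only
    rw [deriv_smoothRamp_of_nonpos (mul_nonpos_of_nonneg_of_nonpos (by positivity) ht),
      indicator_of_notMem (by exact ht.not_gt)]
  · filter_upwards [eventually_one_lt_add_one_mul ht] with k hk
    rw [deriv_smoothRamp_of_one_lt hk, indicator_of_mem (by exact ht), Pi.one_apply]

lemma integral_posPart_mul_divergence (hF : ContDiff ℝ 1 F) (hFc : HasCompactSupport F)
    (hz : ContDiff ℝ 1 z) :
    ∫ x, max (z x) 0 * divergence F x = -∫ x, (Ioi 0).indicator 1 (z x) * fderiv ℝ z x (F x) := by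
  obtain ⟨C, hC⟩ := exists_abs_deriv_smoothRamp_le
  have hdF := continuous_divergence hF
  have hdz : Continuous fun x => fderiv ℝ z x (F x) :=
    (hz.continuous_fderiv one_ne_zero).clm_apply hF.continuous
  have hz₀ := hz.continuous
  have hramp := contDiff_smoothRamp.continuous
  have hramp' := contDiff_smoothRamp.continuous_deriv le_rfl
  have hparts (k : ℕ) :
      ∫ x, smoothRamp (((k : ℝ) + 1) * z x) / ((k : ℝ) + 1) * divergence F x =
      -∫ x, deriv smoothRamp (((k : ℝ) + 1) * z x) * fderiv ℝ z x (F x) := by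
    have hk : (k : ℝ) + 1 ≠ 0 := by positivity
    rw [integral_comp_mul_divergence hF hFc hz (h := fun t =>
      smoothRamp (((k : ℝ) + 1) * t) / ((k : ℝ) + 1))
      ((contDiff_smoothRamp.comp (contDiff_const.mul contDiff_id)).div_const _)]
    simp only [deriv_div_const, deriv_comp_mul_left, smul_eq_mul, mul_div_cancel_left₀ _ hk]
  refine tendsto_nhds_unique (tendsto_integral_of_dominated_convergence
    (fun x => |z x * divergence F x|)
    (fun k => (by fun_prop : Continuous _).aestronglyMeasurable)
    (integrable_mul_divergence hF hFc hz₀).abs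
    (fun k => .of_forall fun x => ?_)
    (.of_forall fun x => (tendsto_smoothRamp_mul_div (z x)).mul_const _))
    ((tendsto_integral_of_dominated_convergence (fun x => C * |fderiv ℝ z x (F x)|)
      (fun k => (by fun_prop : Continuous _).aestronglyMeasurable)
      ((integrable_fderiv_apply hF.continuous hFc hz).abs.const_mul C)
      (fun k => .of_forall fun x => ?_)
      (.of_forall fun x => (tendsto_deriv_smoothRamp_mul (z x)).mul_const _)).neg.congr
        fun k => (hparts k).symm)
  · rw [Real.norm_eq_abs, abs_mul, abs_mul, abs_div, abs_of_pos (by positivity : (0 : ℝ) < k + 1)]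
    refine mul_le_mul_of_nonneg_right (div_le_of_le_mul₀ (by positivity) (abs_nonneg _) ?_)
      (abs_nonneg _)
    refine (abs_smoothRamp_le _).trans_eq ?_
    rw [abs_mul, mul_comm, abs_of_pos (by positivity : (0 : ℝ) < k + 1)]
  · rw [Real.norm_eq_abs, abs_mul]
    exact mul_le_mul_of_nonneg_right (hC _) (abs_nonneg _)

lemma integral_max_mul_divergence (hF : ContDiff ℝ 1 F) (hFc : HasCompactSupport F)
    {U V : Rn n → ℝ} (hU : ContDiff ℝ 1 U) (hV : ContDiff ℝ 1 V) :
    ∫ x, max (U x) (V x) * divergence F x =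
      -((∫ x, {y | V y < U y}.indicator (fun y => fderiv ℝ U y (F y)) x) +
        ∫ x, {y | U y ≤ V y}.indicator (fun y => fderiv ℝ V y (F y)) x) := by
  have hdi {W : Rn n → ℝ} (hW : ContDiff ℝ 1 W) : Integrable fun x => fderiv ℝ W x (F x) :=
    integrable_fderiv_apply hF.continuous hFc hW
  have hlt : MeasurableSet {y | V y < U y} :=
    (isOpen_lt hV.continuous hU.continuous).measurableSet
  have hle : MeasurableSet {y | U y ≤ V y} :=
    (isClosed_le hU.continuous hV.continuous).measurableSet
  have hmax (x : Rn n) : max (U x) (V x) = max (U x - V x) 0 + V x := by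
    rw [max_add, sub_add_cancel, zero_add]
  have hderiv (x : Rn n) : {y | V y < U y}.indicator (fun y => fderiv ℝ U y (F y)) x +
      {y | U y ≤ V y}.indicator (fun y => fderiv ℝ V y (F y)) x =
      (Ioi 0).indicator 1 (U x - V x) * fderiv ℝ (fun y => U y - V y) x (F x) +
        fderiv ℝ V x (F x) := by
    rw [fderiv_fun_sub (hU.differentiable one_ne_zero x) (hV.differentiable one_ne_zero x)]
    by_cases hx : V x < U x
    · simp [indicator, hx, hx.not_ge]
    · simp [indicator, hx, not_lt.1 hx]
  simp only [hmax, add_mul]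
  rw [integral_add (integrable_mul_divergence hF hFc ((hU.sub hV).continuous.max continuous_const))
      (integrable_mul_divergence hF hFc hV.continuous),
    integral_posPart_mul_divergence hF hFc (hU.sub hV), integral_mul_divergence hF hFc hV,
    ← neg_add, ← integral_add ((hdi hU).indicator hlt) ((hdi hV).indicator hle)]
  simp only [hderiv]
  rw [integral_add _ (hdi hV)]
  refine ((hdi (hU.sub hV)).indicator hlt).congr (.of_forall fun x => ?_)
  by_cases hx : V x < U x <;> simp [indicator, hx]

end Divergence

section Commutator

variable {n : ℕ} {p : ℝ} {ρ u q : Rn n → ℝ} {B : Rn n → Rn n}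

lemma fderiv_neg_of_even (hρe : ρ.Even) (x : Rn n) : fderiv ℝ ρ (-x) = -fderiv ℝ ρ x := by
  have hneg := fderiv_comp_smul (𝕜 := ℝ) (f := ρ) (x := x) (-1)
  simp only [neg_smul, one_smul, show (fun y => ρ (-y)) = ρ from funext hρe] at hneg
  rw [hneg, neg_neg]

lemma fderiv_convolution_apply (hρ : ContDiff ℝ 1 ρ) (hρc : HasCompactSupport ρ)
    (hu : LocallyIntegrable u) (x v : Rn n) :
    fderiv ℝ (ρ ⋆ u) x v = ∫ y, fderiv ℝ ρ (x - y) v * u y := by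
  have hint := (hρc.fderiv ℝ).convolutionExists_left
    ((ContinuousLinearMap.lsmul ℝ ℝ).precompL (Rn n)) (hρ.continuous_fderiv one_ne_zero) hu x
  rw [(hρc.hasFDerivAt_convolution_left _ hρ hu x).fderiv, convolution_def,
    ContinuousLinearMap.integral_apply hint, ← integral_sub_left_eq_self _ volume x]
  simp

lemma integrable_mul_fderiv_sub (hρ : ContDiff ℝ 1 ρ) (hρc : HasCompactSupport ρ)
    (hu : LocallyIntegrable u) (x v : Rn n) :
    Integrable fun y => fderiv ℝ ρ (x - y) v * u y := by
  refine hu.integrable_smul_left_of_hasCompactSupport (((hρ.continuous_fderiv one_ne_zero).comp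
    (continuous_const.sub continuous_id)).clm_apply continuous_const) ?_
  exact (hρc.fderiv_apply ℝ v).comp_homeomorph (Homeomorph.subLeft x)

/-- The kernel `div_y (ρ (y - x) B(y))` through which the operator `q ↦ div ((ρ ⋆ q) B)` acts
when `ρ` is even. -/
def transportKernel (ρ : Rn n → ℝ) (B : Rn n → Rn n) (x : Rn n) : Rn n → ℝ :=
  divergence fun y => ρ (y - x) • B y

lemma transportKernel_apply (hρ : ContDiff ℝ 1 ρ) (hB : ContDiff ℝ 1 B) (x y : Rn n) :
    transportKernel ρ B x y = ρ (y - x) * divergence B y + fderiv ℝ ρ (y - x) (B y) := by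
  have hd : DifferentiableAt ℝ (fun y => ρ (y - x)) y :=
    ((hρ.comp (contDiff_id.sub contDiff_const)).differentiable one_ne_zero) y
  rw [transportKernel, divergence_smul hd (hB.differentiable one_ne_zero y), fderiv_comp_sub]

lemma transportKernel_sub_const (hρ : ContDiff ℝ 1 ρ) (hB : ContDiff ℝ 1 B) (v x y : Rn n) :
    transportKernel ρ (fun y => B y - v) x y =
      transportKernel ρ B x y - fderiv ℝ ρ (y - x) v := by
  rw [transportKernel_apply hρ (hB.sub contDiff_const), transportKernel_apply hρ hB,
    divergence_sub_const, map_sub]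
  ring

lemma contDiff_transportField (hρ : ContDiff ℝ 1 ρ) (hB : ContDiff ℝ 1 B) (x : Rn n) :
    ContDiff ℝ 1 fun y => ρ (y - x) • B y :=
  (hρ.comp (contDiff_id.sub contDiff_const)).smul hB

lemma hasCompactSupport_transportField (hρc : HasCompactSupport ρ) (x : Rn n) :
    HasCompactSupport fun y => ρ (y - x) • B y :=
  (hρc.comp_homeomorph (Homeomorph.subRight x)).smul_right

lemma integral_transportKernel (hρ : ContDiff ℝ 1 ρ) (hρc : HasCompactSupport ρ)
    (hB : ContDiff ℝ 1 B) (x : Rn n) : ∫ y, transportKernel ρ B x y = 0 :=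
  integral_divergence (contDiff_transportField hρ hB x) (hasCompactSupport_transportField hρc x)

lemma integrable_mul_transportKernel (hρ : ContDiff ℝ 1 ρ) (hρc : HasCompactSupport ρ)
    (hB : ContDiff ℝ 1 B) (hu : LocallyIntegrable u) (x : Rn n) :
    Integrable fun y => u y * transportKernel ρ B x y := by
  simp only [mul_comm (u _)]
  exact hu.integrable_smul_left_of_hasCompactSupport
    (continuous_divergence (contDiff_transportField hρ hB x))
    (hasCompactSupport_divergence (hasCompactSupport_transportField hρc x))

lemma continuous_transportKernel (hρ : ContDiff ℝ 1 ρ) (hB : ContDiff ℝ 1 B) :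
    Continuous fun z : Rn n × Rn n => transportKernel ρ B z.1 z.2 := by
  simp only [transportKernel_apply hρ hB]
  have := hρ.continuous
  have := hρ.continuous_fderiv one_ne_zero
  have := continuous_divergence hB
  have := hB.continuous
  fun_prop

lemma exists_norm_transportKernel_le (hρ : ContDiff ℝ 1 ρ) (hρc : HasCompactSupport ρ)
    (hB : ContDiff ℝ 1 B) (hBc : HasCompactSupport B) :
    ∃ C, ∀ x y, ‖transportKernel ρ B x y‖ ≤ C := by
  obtain ⟨R, hR⟩ := hρc.exists_bound_of_continuous hρ.continuous
  obtain ⟨R', hR'⟩ := (hρc.fderiv ℝ).exists_bound_of_continuous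
    (hρ.continuous_fderiv one_ne_zero)
  obtain ⟨D, hD⟩ := (hasCompactSupport_divergence hBc).exists_bound_of_continuous
    (continuous_divergence hB)
  obtain ⟨M, hM⟩ := hBc.exists_bound_of_continuous hB.continuous
  refine ⟨R * D + R' * M, fun x y => ?_⟩
  rw [transportKernel_apply hρ hB]
  refine (norm_add_le _ _).trans (add_le_add ?_ ((ContinuousLinearMap.le_opNorm _ _).trans ?_))
  · rw [norm_mul]
    exact mul_le_mul (hR _) (hD y) (norm_nonneg _) ((norm_nonneg _).trans (hR 0))
  · exact mul_le_mul (hR' _) (hM y) (norm_nonneg _) ((norm_nonneg _).trans (hR' 0))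

lemma divergence_convolution_smul (hρ : ContDiff ℝ 1 ρ) (hρc : HasCompactSupport ρ)
    (hB : ContDiff ℝ 1 B) (hq : LocallyIntegrable q) (y : Rn n) :
    divergence (fun y => (ρ ⋆ q) y • B y) y = ∫ x, q x * transportKernel ρ B x y := by
  have hd := (hρc.contDiff_convolution_left (ContinuousLinearMap.lsmul ℝ ℝ) hρ hq).differentiable
    one_ne_zero y
  have hint : Integrable fun x => ρ (y - x) * q x :=
    hq.integrable_smul_left_of_hasCompactSupport
      (hρ.continuous.comp (continuous_const.sub continuous_id))
      (hρc.comp_homeomorph (Homeomorph.subLeft y))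
  rw [divergence_smul hd (hB.differentiable one_ne_zero y), fderiv_convolution_apply hρ hρc hq,
    convolution_eq_integral_sub_mul, ← integral_mul_const,
    ← integral_add (hint.mul_const _) (integrable_mul_fderiv_sub hρ hρc hq y _)]
  refine integral_congr_ae (.of_forall fun x => ?_)
  dsimp only
  rw [transportKernel_apply hρ hB]
  ring

lemma integrable_prod_transportKernel (hρ : ContDiff ℝ 1 ρ) (hρc : HasCompactSupport ρ)
    (hB : ContDiff ℝ 1 B) (hBc : HasCompactSupport B) (hu : LocallyIntegrable u)
    (hq : Integrable q) :
    Integrable (fun z : Rn n × Rn n => u z.2 * (q z.1 * transportKernel ρ B z.1 z.2))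
      (volume.prod volume) := by
  obtain ⟨C, hC⟩ := exists_norm_transportKernel_le hρ hρc hB hBc
  have hu' : Integrable ((tsupport B).indicator u) :=
    (hu.integrableOn_isCompact hBc.isCompact).integrable_indicator
      (isClosed_tsupport B).measurableSet
  refine ((hq.mul_prod hu').mul_bdd (c := C)
    (continuous_transportKernel hρ hB).aestronglyMeasurable
    (.of_forall fun z => hC z.1 z.2)).congr (.of_forall fun z => ?_)
  dsimp only
  by_cases hz : z.2 ∈ tsupport B
  · rw [indicator_of_mem hz]
    ring
  · rw [transportKernel_apply hρ hB, divergence_of_notMem_tsupport hz,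
      image_eq_zero_of_notMem_tsupport hz, map_zero]
    ring

lemma integral_mul_divergence_convolution_smul (hρ : ContDiff ℝ 1 ρ)
    (hρc : HasCompactSupport ρ) (hB : ContDiff ℝ 1 B) (hBc : HasCompactSupport B)
    (hu : LocallyIntegrable u) (hq : Integrable q) :
    ∫ y, u y * divergence (fun y => (ρ ⋆ q) y • B y) y =
      ∫ x, q x * ∫ y, u y * transportKernel ρ B x y := by
  simp only [divergence_convolution_smul hρ hρc hB hq.locallyIntegrable, ← integral_const_mul]
  rw [← integral_integral_swap (integrable_prod_transportKernel hρ hρc hB hBc hu hq)]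
  simp only [mul_left_comm]

lemma integral_mul_transportKernel_add (hρ : ContDiff ℝ 1 ρ) (hρc : HasCompactSupport ρ)
    (hρe : ρ.Even) (hB : ContDiff ℝ 1 B) (hu : LocallyIntegrable u) (x : Rn n) :
    (∫ y, u y * transportKernel ρ B x y) + fderiv ℝ (ρ ⋆ u) x (B x) =
      ∫ y, (u y - u x) * transportKernel ρ (fun y => B y - B x) x y := by
  have hB' : ContDiff ℝ 1 fun y => B y - B x := hB.sub contDiff_const
  have hone : LocallyIntegrable fun _ : Rn n => u x := locallyIntegrable_const _
  simp only [sub_mul]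
  rw [integral_sub (integrable_mul_transportKernel hρ hρc hB' hu x)
      (integrable_mul_transportKernel hρ hρc hB' hone x), integral_const_mul,
    integral_transportKernel hρ hρc hB', mul_zero, sub_zero, fderiv_convolution_apply hρ hρc hu,
    ← integral_add (integrable_mul_transportKernel hρ hρc hB hu x)
      (integrable_mul_fderiv_sub hρ hρc hu x _)]
  refine integral_congr_ae (.of_forall fun y => ?_)
  dsimp only
  rw [transportKernel_sub_const hρ hB, ← neg_sub y x, fderiv_neg_of_even hρe, neg_apply]
  ring

lemma abs_transportKernel_sub_le (hρ : ContDiff ℝ 1 ρ) (hρe : ρ.Even) (hB : ContDiff ℝ 1 B)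
    {L : NNReal} (hL : LipschitzWith L B) {D : ℝ} (hD : ∀ x, |divergence B x| ≤ D)
    (x y : Rn n) :
    |transportKernel ρ (fun y => B y - B x) x y| ≤ (D + L) * commutatorKernel ρ (x - y) := by
  have hD0 : 0 ≤ D := (abs_nonneg _).trans (hD 0)
  rw [transportKernel_apply hρ (hB.sub contDiff_const), divergence_sub_const, commutatorKernel,
    ← neg_sub y x, hρe, fderiv_neg_of_even hρe, norm_neg, norm_neg]
  calc |ρ (y - x) * divergence B y + fderiv ℝ ρ (y - x) (B y - B x)|
      ≤ |ρ (y - x)| * D + ‖fderiv ℝ ρ (y - x)‖ * (L * ‖y - x‖) := by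
        refine (abs_add_le _ _).trans (add_le_add ?_ ?_)
        · rw [abs_mul]
          exact mul_le_mul_of_nonneg_left (hD y) (abs_nonneg _)
        · exact ((fderiv ℝ ρ (y - x)).le_opNorm _).trans
            (mul_le_mul_of_nonneg_left (hL.norm_sub_le y x) (norm_nonneg _))
    _ ≤ (|ρ (y - x)| * D + ‖fderiv ℝ ρ (y - x)‖ * (L * ‖y - x‖)) +
        (|ρ (y - x)| * L + ‖fderiv ℝ ρ (y - x)‖ * (D * ‖y - x‖)) :=
        le_add_of_nonneg_right (by positivity)
    _ = (D + L) * (|ρ (y - x)| + ‖y - x‖ * ‖fderiv ℝ ρ (y - x)‖) := by ring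

lemma abs_integral_mul_transportKernel_add_le (hp : (n : ℝ) < p) (hρ : ContDiff ℝ 1 ρ)
    (hρc : HasCompactSupport ρ) (hρe : ρ.Even) (hB : ContDiff ℝ 1 B)
    {L : NNReal} (hL : LipschitzWith L B) {D : ℝ} (hD : ∀ x, |divergence B x| ≤ D)
    (hu : MemW p u) (x : Rn n) :
    |(∫ y, u y * transportKernel ρ B x y) + fderiv ℝ (ρ ⋆ u) x (B x)| ≤
      (D + L) * oscillation (commutatorKernel ρ) u x := by
  have hp0 : 0 ≤ p := n.cast_nonneg.trans hp.le
  have hK := isDecaying_commutatorKernel hp0 hρ hρc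
  rw [integral_mul_transportKernel_add hρ hρc hρe hB (hu.locallyIntegrable hp0), oscillation,
    ← integral_const_mul, ← Real.norm_eq_abs]
  refine norm_integral_le_of_norm_le ((hu.integrable_oscillation
    (by rwa [finrank_euclideanSpace_fin]) hK x).const_mul (D + L)) (.of_forall fun y => ?_)
  rw [norm_mul, Real.norm_eq_abs, Real.norm_eq_abs, abs_sub_comm, mul_comm, ← mul_assoc]
  exact mul_le_mul_of_nonneg_right (abs_transportKernel_sub_le hρ hρe hB hL hD x y) (abs_nonneg _)

lemma abs_integral_mul_divergence_convolution_add_le (hp : (n : ℝ) < p) (hρ : ContDiff ℝ 1 ρ)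
    (hρc : HasCompactSupport ρ) (hρe : ρ.Even) (hB : ContDiff ℝ 1 B) (hBc : HasCompactSupport B)
    {L : NNReal} (hL : LipschitzWith L B) {D : ℝ} (hD : ∀ x, |divergence B x| ≤ D)
    (hu : MemW p u) (hq : IsDecaying p q) :
    |(∫ y, u y * divergence (fun y => (ρ ⋆ q) y • B y) y) +
      ∫ x, q x * fderiv ℝ (ρ ⋆ u) x (B x)| ≤
      (D + L) * ∫ x, |q x| * oscillation (commutatorKernel ρ) u x := by
  have hp0 : 0 ≤ p := n.cast_nonneg.trans hp.le
  have hp' : (Module.finrank ℝ (Rn n) : ℝ) < p := by rwa [finrank_euclideanSpace_fin]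
  have hu' := hu.locallyIntegrable hp0
  have hK := isDecaying_commutatorKernel hp0 hρ hρc
  have hU : ContDiff ℝ 1 (ρ ⋆ u) := hρc.contDiff_convolution_left _ hρ hu'
  have hqu : Integrable fun x => q x * ∫ y, u y * transportKernel ρ B x y := by
    simpa only [mul_left_comm (u _), integral_const_mul] using
      (integrable_prod_transportKernel hρ hρc hB hBc hu' (hq.integrable hp')).integral_prod_left
  have hqU : Integrable fun x => q x * fderiv ℝ (ρ ⋆ u) x (B x) := by
    obtain ⟨C, hC0, hC⟩ := hq.exists_nonneg_bound
    refine (integrable_fderiv_apply hB.continuous hBc hU).bdd_mul (c := C) hq.1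
      (.of_forall fun x => (hC x).trans
        (mul_le_of_le_one_right hC0 (weight_le_one p x)))
  have hosc : Integrable fun x => |q x| * oscillation (commutatorKernel ρ) u x :=
    ((hu.oscillation hp' hK (commutatorKernel_nonneg ρ)).mul_integrable hp0 hq.abs).congr
      (.of_forall fun x => mul_comm _ _)
  rw [integral_mul_divergence_convolution_smul hρ hρc hB hBc hu' (hq.integrable hp'),
    ← integral_add hqu hqU, ← integral_const_mul, ← Real.norm_eq_abs]
  refine norm_integral_le_of_norm_le (hosc.const_mul (D + L)) (.of_forall fun x => ?_)
  rw [← mul_add, norm_mul, Real.norm_eq_abs, Real.norm_eq_abs, mul_left_comm (D + _)]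
  exact mul_le_mul_of_nonneg_left (abs_integral_mul_transportKernel_add_le hp hρ hρc hρe hB hL
    hD hu x) (abs_nonneg _)

end Commutator

section MollificationDefect

variable {E : Type*} [NormedAddCommGroup E] [NormedSpace ℝ E] [FiniteDimensional ℝ E]
  [MeasureSpace E] [BorelSpace E] [(volume : Measure E).IsAddHaarMeasure] {p C : ℝ}
  {ρ u v q : E → ℝ}

lemma integral_oscillation_mul_abs_le (hp : Module.finrank ℝ E < p) (hρ : ContDiff ℝ 1 ρ)
    (hρc : HasCompactSupport ρ) (hu : MemW p u) (hq : AEStronglyMeasurable q)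
    (hC : ∀ x, |q x| ≤ C * weight p x) :
    ∫ x, oscillation (commutatorKernel ρ) u x * |q x| ≤ C * mollificationDefect p ρ u := by
  have hp0 : 0 ≤ p := (Nat.cast_nonneg _).trans hp.le
  have hosc := hu.oscillation hp (isDecaying_commutatorKernel hp0 hρ hρc)
    (commutatorKernel_nonneg ρ)
  rw [mollificationDefect, ← integral_const_mul]
  refine integral_mono (hosc.mul_integrable hp0 (IsDecaying.abs ⟨hq, C, hC⟩))
    (Integrable.const_mul hosc C) fun x => ?_
  dsimp only
  rw [mul_left_comm]
  exact mul_le_mul_of_nonneg_left (hC x) (integral_nonneg fun y =>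
    mul_nonneg (commutatorKernel_nonneg ρ _) (abs_nonneg _))

lemma abs_convolution_sub_le_oscillation_commutatorKernel (hp : Module.finrank ℝ E < p)
    (hρ : ContDiff ℝ 1 ρ) (hρc : HasCompactSupport ρ) (hρ0 : 0 ≤ ρ) (hρ1 : ∫ x, ρ x = 1)
    (hu : MemW p u) (x : E) :
    |(ρ ⋆ u) x - u x| ≤ oscillation (commutatorKernel ρ) u x := by
  have hp0 : 0 ≤ p := (Nat.cast_nonneg _).trans hp.le
  have hρd := IsDecaying.of_continuous hp0 hρ.continuous hρc
  refine (abs_convolution_sub_le hp hρd hρ0 hρ1 hu x).trans (integral_mono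
    (hu.integrable_oscillation hp hρd x) (hu.integrable_oscillation hp
      (isDecaying_commutatorKernel hp0 hρ hρc) x) fun y =>
    mul_le_mul_of_nonneg_right ?_ (abs_nonneg _))
  exact (le_abs_self _).trans (le_add_of_nonneg_right (by positivity))

lemma integral_mul_convolution_le (hp : Module.finrank ℝ E < p) (hρ : ContDiff ℝ 1 ρ)
    (hρc : HasCompactSupport ρ) (hρe : ρ.Even) (hρ0 : 0 ≤ ρ) (hρ1 : ∫ x, ρ x = 1)
    (hu : MemW p u) (hq : AEStronglyMeasurable q) (hC : ∀ x, |q x| ≤ C * weight p x) :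
    ∫ x, u x * (ρ ⋆ q) x ≤ (∫ x, u x * q x) + C * mollificationDefect p ρ u := by
  have hp0 : 0 ≤ p := (Nat.cast_nonneg _).trans hp.le
  have hρd := IsDecaying.of_continuous hp0 hρ.continuous hρc
  have hqd : IsDecaying p q := ⟨hq, C, hC⟩
  have hosc := (hu.oscillation hp (isDecaying_commutatorKernel hp0 hρ hρc)
    (commutatorKernel_nonneg ρ)).mul_integrable hp0 hqd.abs
  calc ∫ x, u x * (ρ ⋆ q) x = ∫ x, (ρ ⋆ u) x * q x := integral_mul_convolution hp hqd hρd hρe hu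
    _ ≤ ∫ x, (u x * q x + oscillation (commutatorKernel ρ) u x * |q x|) := by
        refine integral_mono ((hu.convolution hp hρd).mul_integrable hp0 hqd)
          ((hu.mul_integrable hp0 hqd).add hosc) fun x => ?_
        have h := mul_le_mul_of_nonneg_right
          (abs_convolution_sub_le_oscillation_commutatorKernel hp hρ hρc hρ0 hρ1 hu x)
          (abs_nonneg (q x))
        rw [← abs_mul, sub_mul] at h
        linarith [le_abs_self ((ρ ⋆ u) x * q x - u x * q x)]
    _ ≤ (∫ x, u x * q x) + C * mollificationDefect p ρ u := by
        rw [integral_add (hu.mul_integrable hp0 hqd) hosc]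
        exact add_le_add le_rfl (integral_oscillation_mul_abs_le hp hρ hρc hu hq hC)

lemma abs_integral_max_convolution_mul_sub_le (hp : Module.finrank ℝ E < p) (hρ : ContDiff ℝ 1 ρ)
    (hρc : HasCompactSupport ρ) (hρ0 : 0 ≤ ρ) (hρ1 : ∫ x, ρ x = 1) (hu : MemW p u)
    (hv : MemW p v) (hq : AEStronglyMeasurable q) (hC : ∀ x, |q x| ≤ C * weight p x) :
    |(∫ x, max ((ρ ⋆ u) x) ((ρ ⋆ v) x) * q x) - ∫ x, max (u x) (v x) * q x| ≤
      C * (mollificationDefect p ρ u + mollificationDefect p ρ v) := by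
  have hp0 : 0 ≤ p := (Nat.cast_nonneg _).trans hp.le
  have hρd := IsDecaying.of_continuous hp0 hρ.continuous hρc
  have hqd : IsDecaying p q := ⟨hq, C, hC⟩
  have hosc {w : E → ℝ} (hw : MemW p w) := (hw.oscillation hp
    (isDecaying_commutatorKernel hp0 hρ hρc) (commutatorKernel_nonneg ρ)).mul_integrable hp0
      hqd.abs
  rw [← integral_sub (((hu.convolution hp hρd).max (hv.convolution hp hρd)).mul_integrable hp0 hqd)
    ((hu.max hv).mul_integrable hp0 hqd), mul_add, ← Real.norm_eq_abs]
  refine (norm_integral_le_of_norm_le ((hosc hu).add (hosc hv)) (.of_forall fun x => ?_)).trans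
    ((integral_add (hosc hu) (hosc hv)).trans_le (add_le_add
      (integral_oscillation_mul_abs_le hp hρ hρc hu hq hC)
      (integral_oscillation_mul_abs_le hp hρ hρc hv hq hC)))
  have hclose {w : E → ℝ} (hw : MemW p w) :=
    abs_convolution_sub_le_oscillation_commutatorKernel hp hρ hρc hρ0 hρ1 hw x
  rw [← sub_mul, norm_mul, Real.norm_eq_abs, Real.norm_eq_abs, Pi.add_apply, ← add_mul]
  refine mul_le_mul_of_nonneg_right ((abs_max_sub_max_le_max _ _ _ _).trans
    ((max_le_add_of_nonneg (abs_nonneg _) (abs_nonneg _)).trans ?_)) (abs_nonneg _)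
  exact add_le_add (hclose hu) (hclose hv)

lemma tendsto_integral_max_mollifier_convolution_mul (hp : Module.finrank ℝ E < p)
    (hu : MemW p u) (hv : MemW p v) (hq : IsDecaying p q) :
    Tendsto (fun k => ∫ x, max ((mollifier k ⋆ u) x) ((mollifier k ⋆ v) x) * q x) atTop
      (𝓝 (∫ x, max (u x) (v x) * q x)) := by
  obtain ⟨C, hC⟩ := hq.2
  refine tendsto_iff_norm_sub_tendsto_zero.2 (squeeze_zero (fun k => norm_nonneg _)
    (fun k => abs_integral_max_convolution_mul_sub_le hp (contDiff_mollifier k)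
      (hasCompactSupport_mollifier k) (mollifier_nonneg k) (integral_mollifier k) hu hv hq.1 hC) ?_)
  simpa using ((tendsto_mollificationDefect hp hu).add
    (tendsto_mollificationDefect hp hv)).const_mul C

end MollificationDefect

section MaxDrift

variable {n : ℕ} {p : ℝ} {ρ u v φ : Rn n → ℝ} {B : Rn n → Rn n}

lemma integral_mul_divergence_indicator_le (hp : (n : ℝ) < p) (hρ : ContDiff ℝ 1 ρ)
    (hρc : HasCompactSupport ρ) (hρe : ρ.Even) (hB : ContDiff ℝ 1 B) (hBc : HasCompactSupport B)
    {L : NNReal} (hL : LipschitzWith L B) {D : ℝ} (hD : ∀ x, |divergence B x| ≤ D)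
    (hu : MemW p u) (hφ : AEStronglyMeasurable φ) {C : ℝ} (hC : ∀ x, |φ x| ≤ C * weight p x)
    {S : Set (Rn n)} (hS : MeasurableSet S) :
    ∫ x, u x * divergence (fun y => (ρ ⋆ S.indicator φ) y • B y) x ≤
      -(∫ x, S.indicator (fun y => fderiv ℝ (ρ ⋆ u) y (φ y • B y)) x) +
        (D + L) * (C * mollificationDefect p ρ u) := by
  have hp' : (Module.finrank ℝ (Rn n) : ℝ) < p := by rwa [finrank_euclideanSpace_fin]
  have hq (x : Rn n) : |S.indicator φ x| ≤ C * weight p x :=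
    (norm_indicator_le_norm_self φ x).trans (hC x)
  have hcomm := abs_integral_mul_divergence_convolution_add_le hp hρ hρc hρe hB hBc hL hD hu
    ⟨hφ.indicator hS, C, hq⟩
  have hdefect := integral_oscillation_mul_abs_le hp' hρ hρc hu (hφ.indicator hS) hq
  have hDL : 0 ≤ D + L := add_nonneg ((abs_nonneg _).trans (hD 0)) L.2
  have hind (x : Rn n) : S.indicator (fun y => fderiv ℝ (ρ ⋆ u) y (φ y • B y)) x =
      S.indicator φ x * fderiv ℝ (ρ ⋆ u) x (B x) := by
    by_cases hx : x ∈ S <;> simp [hx]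
  simp only [mul_comm |_|] at hcomm
  simp only [hind]
  linarith [le_of_abs_le hcomm, mul_le_mul_of_nonneg_left hdefect hDL]

lemma integral_mul_divergence_add_le_integral_max (hp : (n : ℝ) < p) (hρ : ContDiff ℝ 1 ρ)
    (hρc : HasCompactSupport ρ) (hρe : ρ.Even) (hB : ContDiff ℝ 1 B) (hBc : HasCompactSupport B)
    {L : NNReal} (hL : LipschitzWith L B) {D : ℝ} (hD : ∀ x, |divergence B x| ≤ D)
    (hu : MemW p u) (hv : MemW p v) (hφ : ContDiff ℝ 1 φ) {C : ℝ}
    (hC : ∀ x, |φ x| ≤ C * weight p x) :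
    (∫ x, u x * divergence
        (fun y => (ρ ⋆ {z | (ρ ⋆ v) z < (ρ ⋆ u) z}.indicator φ) y • B y) x) +
      (∫ x, v x * divergence
        (fun y => (ρ ⋆ {z | (ρ ⋆ u) z ≤ (ρ ⋆ v) z}.indicator φ) y • B y) x) ≤
      (∫ x, max ((ρ ⋆ u) x) ((ρ ⋆ v) x) * divergence (fun y => φ y • B y) x) +
        (D + L) * (C * (mollificationDefect p ρ u + mollificationDefect p ρ v)) := by
  have hsmooth {w : Rn n → ℝ} (hw : MemW p w) : ContDiff ℝ 1 (ρ ⋆ w) :=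
    hρc.contDiff_convolution_left _ hρ (hw.locallyIntegrable (n.cast_nonneg.trans hp.le))
  have hU := hsmooth hu
  have hV := hsmooth hv
  have hφm := hφ.continuous.aestronglyMeasurable (μ := volume)
  have hlt := integral_mul_divergence_indicator_le hp hρ hρc hρe hB hBc hL hD hu hφm hC
    (measurableSet_lt hV.continuous.measurable hU.continuous.measurable)
  have hle := integral_mul_divergence_indicator_le hp hρ hρc hρe hB hBc hL hD hv hφm hC
    (measurableSet_le hU.continuous.measurable hV.continuous.measurable)
  have hφB : ContDiff ℝ 1 fun y => φ y • B y := hφ.smul hB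
  have hφBc : HasCompactSupport fun y => φ y • B y :=
    hBc.smul_left (f := φ)
  refine (add_le_add hlt hle).trans_eq ?_
  rw [integral_max_mul_divergence hφB hφBc hU hV]
  ring

end MaxDrift

section MaxRhs

variable {n : ℕ} {u v F G : Rn n → ℝ} {x : Rn n}

lemma maxRhs_of_lt (h : v x < u x) : maxRhs u v F G x = F x := by
  simp [maxRhs, indicator, h, h.not_gt, h.ne']

lemma maxRhs_of_gt (h : u x < v x) : maxRhs u v F G x = G x := by
  simp [maxRhs, indicator, h, h.not_gt, h.ne]

lemma maxRhs_of_eq (h : u x = v x) : maxRhs u v F G x = max (F x) (G x) := by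
  simp [maxRhs, indicator, h]

lemma maxRhs_sub_mul (c : Rn n → ℝ) :
    maxRhs u v (fun y => F y - c y * u y) (fun y => G y - c y * v y) =
      fun y => maxRhs u v F G y - c y * max (u y) (v y) := by
  ext x
  rcases lt_trichotomy (u x) (v x) with h | h | h
  · rw [maxRhs_of_gt h, maxRhs_of_gt h, max_eq_right h.le]
  · rw [maxRhs_of_eq h, maxRhs_of_eq h, h, max_self, max_sub_sub_right]
  · rw [maxRhs_of_lt h, maxRhs_of_lt h, max_eq_left h.le]

lemma maxRhs_mul (c : Rn n → ℝ) :
    maxRhs u v (fun y => c y * u y) (fun y => c y * v y) = fun y => c y * max (u y) (v y) := by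
  ext x
  rcases lt_trichotomy (u x) (v x) with h | h | h
  · rw [maxRhs_of_gt h, max_eq_right h.le]
  · rw [maxRhs_of_eq h, h, max_self, max_self]
  · rw [maxRhs_of_lt h, max_eq_left h.le]

lemma maxRhs_indicator (K : Set (Rn n)) :
    maxRhs u v (K.indicator F) (K.indicator G) = K.indicator (maxRhs u v F G) := by
  ext x
  by_cases hx : x ∈ K <;> simp [maxRhs, indicator, hx]

lemma abs_maxRhs_le : |maxRhs u v F G x| ≤ |F x| + |G x| := by
  rcases lt_trichotomy (u x) (v x) with h | h | h
  · rw [maxRhs_of_gt h]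
    exact le_add_of_nonneg_left (abs_nonneg _)
  · rw [maxRhs_of_eq h]
    exact abs_max_le_max_abs_abs.trans (max_le_add_of_nonneg (abs_nonneg _) (abs_nonneg _))
  · rw [maxRhs_of_lt h]
    exact le_add_of_nonneg_right (abs_nonneg _)

lemma integrable_maxRhs {μ : Measure (Rn n)} (hu : AEMeasurable u μ) (hv : AEMeasurable v μ)
    (hF : Integrable F μ) (hG : Integrable G μ) : Integrable (maxRhs u v F G) μ :=
  (hF.abs.add hG.abs).mono'
    (((hF.1.indicator₀ (nullMeasurableSet_lt hv hu)).add
      (hG.1.indicator₀ (nullMeasurableSet_lt hu hv))).add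
        ((hF.1.sup hG.1).indicator₀ (nullMeasurableSet_eq_fun hu hv)))
    (.of_forall fun _ => abs_maxRhs_le)

lemma locallyIntegrableOn_maxRhs {Ω : Opens (Rn n)} (hu : AEMeasurable u) (hv : AEMeasurable v)
    (hF : LocallyIntegrableOn F Ω) (hG : LocallyIntegrableOn G Ω) :
    LocallyIntegrableOn (maxRhs u v F G) Ω :=
  (locallyIntegrableOn_iff Ω.isOpen.isLocallyClosed).2 fun _ hKΩ hK =>
    integrable_maxRhs hu.restrict hv.restrict (hF.integrableOn_compact_subset hKΩ hK)
      (hG.integrableOn_compact_subset hKΩ hK)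

variable {ι : Type*} {l : Filter ι} {U V : ι → Rn n → ℝ} {φ : Rn n → ℝ}

/-- The function equal to `F` where `v < u` and to `G` elsewhere. -/
def selectRhs (u v F G : Rn n → ℝ) (x : Rn n) : ℝ :=
  {y | v y < u y}.indicator F x + {y | u y ≤ v y}.indicator G x

lemma selectRhs_of_lt (h : v x < u x) : selectRhs u v F G x = F x := by
  simp [selectRhs, indicator, h, h.not_ge]

lemma selectRhs_of_le (h : u x ≤ v x) : selectRhs u v F G x = G x := by
  simp [selectRhs, indicator, h, h.not_gt]

lemma abs_selectRhs_le : |selectRhs u v F G x| ≤ |F x| + |G x| :=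
  (abs_add_le _ _).trans
    (add_le_add (norm_indicator_le_norm_self F x) (norm_indicator_le_norm_self G x))

lemma aestronglyMeasurable_selectRhs (hu : AEMeasurable u) (hv : AEMeasurable v)
    (hF : AEStronglyMeasurable F) (hG : AEStronglyMeasurable G) :
    AEStronglyMeasurable (selectRhs u v F G) :=
  (hF.indicator₀ (nullMeasurableSet_lt hv hu)).add (hG.indicator₀ (nullMeasurableSet_le hu hv))

/-- Where `u = v` the sign of `U i - V i` is not determined, but there `maxRhs` is the larger of
the two candidate values. -/
lemma eventually_selectRhs_le_maxRhs (hU : Tendsto (fun i => U i x) l (𝓝 (u x)))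
    (hV : Tendsto (fun i => V i x) l (𝓝 (v x))) :
    ∀ᶠ i in l, selectRhs (U i) (V i) F G x ≤ maxRhs u v F G x := by
  rcases lt_trichotomy (u x) (v x) with h | h | h
  · filter_upwards [hU.eventually_lt hV h] with i hi
    rw [selectRhs_of_le hi.le, maxRhs_of_gt h]
  · refine .of_forall fun i => ?_
    rw [maxRhs_of_eq h]
    rcases lt_or_ge (V i x) (U i x) with hi | hi
    · exact (selectRhs_of_lt hi).trans_le (le_max_left _ _)
    · exact (selectRhs_of_le hi).trans_le (le_max_right _ _)
  · filter_upwards [hV.eventually_lt hU h] with i hi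
    rw [selectRhs_of_lt hi, maxRhs_of_lt h]

lemma integral_selectRhs_mul_le {U V : Rn n → ℝ} (hU : AEMeasurable U) (hV : AEMeasurable V)
    (hu : AEMeasurable u) (hv : AEMeasurable v) (hF : Integrable F) (hG : Integrable G)
    (hφ : AEStronglyMeasurable φ) {A : ℝ} (hA : ∀ x, ‖φ x‖ ≤ A) (hφ0 : 0 ≤ φ) :
    ∫ x, selectRhs U V F G x * φ x ≤
      ∫ x, max (selectRhs U V F G x) (maxRhs u v F G x) * φ x := by
  have hselect : Integrable (selectRhs U V F G) :=
    (hF.abs.add hG.abs).mono' (aestronglyMeasurable_selectRhs hU hV hF.1 hG.1)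
      (.of_forall fun _ => abs_selectRhs_le)
  exact integral_mono (hselect.mul_bdd hφ (.of_forall hA))
    ((hselect.sup (integrable_maxRhs hu hv hF hG)).mul_bdd hφ (.of_forall hA))
    fun x => mul_le_mul_of_nonneg_right (le_max_left _ _) (hφ0 x)

lemma tendsto_integral_max_selectRhs_mul [l.IsCountablyGenerated] (hUm : ∀ i, AEMeasurable (U i))
    (hVm : ∀ i, AEMeasurable (V i)) (hu : AEMeasurable u) (hv : AEMeasurable v)
    (hF : Integrable F) (hG : Integrable G) (hφ : AEStronglyMeasurable φ) {A : ℝ}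
    (hA : ∀ x, ‖φ x‖ ≤ A) (hU : ∀ᵐ x, Tendsto (fun i => U i x) l (𝓝 (u x)))
    (hV : ∀ᵐ x, Tendsto (fun i => V i x) l (𝓝 (v x))) :
    Tendsto (fun i => ∫ x, max (selectRhs (U i) (V i) F G x) (maxRhs u v F G x) * φ x) l
      (𝓝 (∫ x, maxRhs u v F G x * φ x)) := by
  refine tendsto_integral_filter_of_dominated_convergence (fun x => (|F x| + |G x|) * A)
    (.of_forall fun i => ((aestronglyMeasurable_selectRhs (hUm i) (hVm i) hF.1 hG.1).sup
      (integrable_maxRhs hu hv hF hG).1).mul hφ) (.of_forall fun i => .of_forall fun x => ?_)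
    ((hF.abs.add hG.abs).mul_const A) ?_
  · rw [norm_mul]
    exact mul_le_mul (abs_max_le_max_abs_abs.trans (max_le abs_selectRhs_le abs_maxRhs_le))
      (hA x) (norm_nonneg _) (by positivity)
  · filter_upwards [hU, hV] with x hUx hVx
    refine tendsto_nhds_of_eventually_eq ?_
    filter_upwards [eventually_selectRhs_le_maxRhs (F := F) (G := G) hUx hVx] with i hi
    rw [max_eq_right hi]

lemma tendsto_integral_max_selectRhs_mollifier_mul (hu : LocallyIntegrable u)
    (hv : LocallyIntegrable v) (hF : Integrable F) (hG : Integrable G)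
    (hφ : AEStronglyMeasurable φ) {A : ℝ} (hA : ∀ x, ‖φ x‖ ≤ A) :
    Tendsto (fun k => ∫ x, max (selectRhs (mollifier k ⋆ u) (mollifier k ⋆ v) F G x)
      (maxRhs u v F G x) * φ x) atTop (𝓝 (∫ x, maxRhs u v F G x * φ x)) :=
  tendsto_integral_max_selectRhs_mul
    (fun k => (continuous_mollifier_convolution k hu).aemeasurable)
    (fun k => (continuous_mollifier_convolution k hv).aemeasurable)
    hu.aestronglyMeasurable.aemeasurable hv.aestronglyMeasurable.aemeasurable hF hG hφ hA
    (ae_tendsto_mollifier_convolution hu) (ae_tendsto_mollifier_convolution hv)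

end MaxRhs

section MaxSubsolution

variable {n : ℕ} {s : ℝ} {B : Rn n → Rn n} {u v F G φ ρ : Rn n → ℝ}

/-- The inequality `(-Δ)^s u + B · ∇u ≤ F` on `ℝⁿ`, tested against the single function `ψ`. -/
def SubsolutionTest (s : ℝ) (B : Rn n → Rn n) (u F ψ : Rn n → ℝ) : Prop :=
  (∫ x, u x * fracLaplacian s ψ x) - (∫ x, u x * divergence (fun y => ψ y • B y) x) ≤
    ∫ x, F x * ψ x

lemma integral_mul_indicator_add_eq_selectRhs {U V : Rn n → ℝ} (hU : Continuous U)
    (hV : Continuous V) (hF : Integrable F) (hG : Integrable G) (hφ : Continuous φ)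
    (hφc : HasCompactSupport φ) :
    (∫ x, F x * {y | V y < U y}.indicator φ x) + (∫ x, G x * {y | U y ≤ V y}.indicator φ x) =
      ∫ x, selectRhs U V F G x * φ x := by
  obtain ⟨A, hA⟩ := hφc.exists_bound_of_continuous hφ
  have hint {H : Rn n → ℝ} (hH : Integrable H) {S : Set (Rn n)} (hS : MeasurableSet S) :
      Integrable fun x => H x * S.indicator φ x :=
    hH.mul_bdd (c := A) (hφ.aestronglyMeasurable.indicator hS)
      (.of_forall fun x => (norm_indicator_le_norm_self φ x).trans (hA x))
  rw [← integral_add (hint hF (isOpen_lt hV hU).measurableSet)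
    (hint hG (isClosed_le hU hV).measurableSet)]
  congr 1 with x
  rcases lt_or_ge (V x) (U x) with h | h
  · simp [selectRhs_of_lt h, indicator, h, h.not_ge]
  · simp [selectRhs_of_le h, indicator, h, h.not_gt]

lemma SubsolutionTest.max_convolution_le (hs0 : 0 < s) (hs1 : s < 1) (hρ : ContDiff ℝ 2 ρ)
    (hρc : HasCompactSupport ρ) (hρe : ρ.Even) (hρ0 : 0 ≤ ρ) (hρ1 : ∫ x, ρ x = 1)
    (hB : ContDiff ℝ 1 B) (hBc : HasCompactSupport B) {L : NNReal} (hL : LipschitzWith L B)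
    {D : ℝ} (hD : ∀ x, |divergence B x| ≤ D) (hu : MemW (n + 2 * s) u) (hv : MemW (n + 2 * s) v)
    (hF : Integrable F) (hG : Integrable G) (hφ : ContDiff ℝ 2 φ) (hφc : HasCompactSupport φ)
    (hφ0 : 0 ≤ φ) {C : ℝ} (hC : ∀ x, |φ x| ≤ C * weight (n + 2 * s) x)
    (hsubu : SubsolutionTest s B u F (ρ ⋆ {y | (ρ ⋆ v) y < (ρ ⋆ u) y}.indicator φ))
    (hsubv : SubsolutionTest s B v G (ρ ⋆ {y | (ρ ⋆ u) y ≤ (ρ ⋆ v) y}.indicator φ)) :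
    (∫ x, max ((ρ ⋆ u) x) ((ρ ⋆ v) x) * fracLaplacian s φ x) -
        (∫ x, max ((ρ ⋆ u) x) ((ρ ⋆ v) x) * divergence (fun y => φ y • B y) x) ≤
      (∫ x, selectRhs (ρ ⋆ u) (ρ ⋆ v) F G x * φ x) +
        C * ((D + L) * (mollificationDefect (n + 2 * s) ρ u +
            mollificationDefect (n + 2 * s) ρ v) +
          (mollificationDefect (n + 2 * s) ρ F + mollificationDefect (n + 2 * s) ρ G)) := by
  have hp := finrank_lt_add_two_mul (n := n) hs0
  have hp0 : 0 ≤ n + 2 * s := by positivity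
  have hρ' : ContDiff ℝ 1 ρ := hρ.of_le one_le_two
  have hcont {w : Rn n → ℝ} (hw : MemW (n + 2 * s) w) : Continuous (ρ ⋆ w) :=
    hρc.continuous_convolution_left _ hρ.continuous (hw.locallyIntegrable hp0)
  have hsource {H : Rn n → ℝ} (hH : Integrable H) {S : Set (Rn n)} (hS : MeasurableSet S) :=
    integral_mul_convolution_le hp hρ' hρc hρe hρ0 hρ1 (MemW.of_integrable hp0 hH)
      (hφ.continuous.aestronglyMeasurable.indicator hS)
      (fun x => (norm_indicator_le_norm_self φ x).trans (hC x))
  have hlap := integral_max_convolution_mul_fracLaplacian_le hs0 hs1 hρ hρc hρe hu hv hφ hφc hφ0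
  have hdrift := integral_mul_divergence_add_le_integral_max
    (by rwa [finrank_euclideanSpace_fin] at hp) hρ' hρc hρe hB hBc hL hD hu hv
    (hφ.of_le one_le_two) hC
  have hF' := hsource hF (isOpen_lt (hcont hv) (hcont hu)).measurableSet
  have hG' := hsource hG (isClosed_le (hcont hu) (hcont hv)).measurableSet
  rw [← integral_mul_indicator_add_eq_selectRhs (hcont hu) (hcont hv) hF hG hφ.continuous hφc]
  unfold SubsolutionTest at hsubu hsubv
  linarith

/-- Nonnegative smooth test functions supported in `K`. -/
structure IsTestIn (K : Set (Rn n)) (ψ : Rn n → ℝ) : Prop where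
  contDiff : ContDiff ℝ (⊤ : ℕ∞) ψ
  hasCompactSupport : HasCompactSupport ψ
  nonneg : 0 ≤ ψ
  tsupport_subset : tsupport ψ ⊆ K

lemma tsupport_mollifier_convolution_subset (k : ℕ) (q : Rn n → ℝ) :
    tsupport (mollifier k ⋆ q) ⊆ Metric.cthickening ((k : ℝ) + 1)⁻¹ (tsupport q) := by
  refine closure_minimal ((support_convolution_subset_swap _).trans ?_) Metric.isClosed_cthickening
  rintro _ ⟨y, hy, z, hz, rfl⟩
  refine Metric.mem_cthickening_of_dist_le _ y _ _ (subset_tsupport q hy) ?_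
  have hz' := subset_tsupport _ hz
  rw [tsupport_mollifier, mem_closedBall_zero_iff] at hz'
  simpa [dist_eq_norm] using hz'

lemma IsTestIn.mollifier_convolution_indicator {K K' S : Set (Rn n)} (hφ : IsTestIn K φ)
    (hS : MeasurableSet S) {k : ℕ}
    (hK' : Metric.cthickening ((k : ℝ) + 1)⁻¹ (tsupport φ) ⊆ K') :
    IsTestIn K' (mollifier k ⋆ S.indicator φ) where
  contDiff := (hasCompactSupport_mollifier k).contDiff_convolution_left _ (contDiff_mollifier k)
    ((hφ.contDiff.continuous.integrable_of_hasCompactSupport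
      hφ.hasCompactSupport).indicator hS).locallyIntegrable
  hasCompactSupport := (hasCompactSupport_mollifier k).convolution _
    (hφ.hasCompactSupport.mono (support_indicator.trans_subset inter_subset_right))
  nonneg := fun _ => integral_nonneg fun y => mul_nonneg (mollifier_nonneg k y)
    (indicator_nonneg (fun z _ => hφ.nonneg z) _)
  tsupport_subset := (tsupport_mollifier_convolution_subset k _).trans
    ((Metric.cthickening_subset_of_subset _ (closure_mono
      (support_indicator.trans_subset inter_subset_right))).trans hK')

lemma tendsto_integral_max_mollifier_convolution_mul_fracLaplacian_sub (hs0 : 0 < s) (hs1 : s < 1)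
    (hB : ContDiff ℝ 1 B) (hBc : HasCompactSupport B) (hu : MemW (n + 2 * s) u)
    (hv : MemW (n + 2 * s) v) (hφ : ContDiff ℝ 2 φ) (hφc : HasCompactSupport φ) :
    Tendsto (fun k =>
        (∫ x, max ((mollifier k ⋆ u) x) ((mollifier k ⋆ v) x) * fracLaplacian s φ x) -
          ∫ x, max ((mollifier k ⋆ u) x) ((mollifier k ⋆ v) x) *
            divergence (fun y => φ y • B y) x) atTop
      (𝓝 ((∫ x, max (u x) (v x) * fracLaplacian s φ x) -
        ∫ x, max (u x) (v x) * divergence (fun y => φ y • B y) x)) := by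
  have hp := finrank_lt_add_two_mul (n := n) hs0
  exact (tendsto_integral_max_mollifier_convolution_mul hp hu hv
    (isDecaying_fracLaplacian hs0 hs1 hφ hφc)).sub
      (tendsto_integral_max_mollifier_convolution_mul hp hu hv (.of_continuous (by positivity)
        (continuous_divergence ((hφ.of_le one_le_two).smul hB))
        (hasCompactSupport_divergence (hBc.smul_left (f := φ)))))

lemma SubsolutionTest.max (hs0 : 0 < s) (hs1 : s < 1) (hB : ContDiff ℝ 1 B)
    (hBc : HasCompactSupport B) (hu : MemW (n + 2 * s) u) (hv : MemW (n + 2 * s) v)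
    (hF : Integrable F) (hG : Integrable G) {K : Set (Rn n)} (hφ : IsTestIn K φ) {r : ℝ}
    (hr : 0 < r) (hrK : Metric.cthickening r (tsupport φ) ⊆ K)
    (hsubu : ∀ ψ, IsTestIn K ψ → SubsolutionTest s B u F ψ)
    (hsubv : ∀ ψ, IsTestIn K ψ → SubsolutionTest s B v G ψ) :
    SubsolutionTest s B (fun x => Max.max (u x) (v x)) (maxRhs u v F G) φ := by
  have hp := finrank_lt_add_two_mul (n := n) hs0
  have hp0 : 0 ≤ n + 2 * s := by positivity
  have hφ2 : ContDiff ℝ 2 φ := hφ.contDiff.of_le (WithTop.coe_le_coe.2 le_top)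
  obtain ⟨A, hA⟩ := hφ.hasCompactSupport.exists_bound_of_continuous hφ.contDiff.continuous
  obtain ⟨C, hC⟩ :=
    (IsDecaying.of_continuous hp0 hφ.contDiff.continuous hφ.hasCompactSupport).exists_bound
  obtain ⟨D, hD⟩ := (hasCompactSupport_divergence hBc).exists_bound_of_continuous
    (continuous_divergence hB)
  obtain ⟨L, hL⟩ := hB.lipschitzWith_of_hasCompactSupport hBc one_ne_zero
  have hum := (hu.aestronglyMeasurable hp0).aemeasurable
  have hvm := (hv.aestronglyMeasurable hp0).aemeasurable
  have hφm := hφ.contDiff.continuous.aestronglyMeasurable (μ := volume)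
  have hsource := tendsto_integral_max_selectRhs_mollifier_mul (hu.locallyIntegrable hp0)
    (hv.locallyIntegrable hp0) hF hG hφm hA
  have hdefect := ((((tendsto_mollificationDefect hp hu).add
    (tendsto_mollificationDefect hp hv)).const_mul (D + L)).add
    ((tendsto_mollificationDefect hp (.of_integrable hp0 hF)).add
      (tendsto_mollificationDefect hp (.of_integrable hp0 hG)))).const_mul C
  have hrhs := hsource.add hdefect
  simp only [add_zero, mul_zero] at hrhs
  refine le_of_tendsto_of_tendsto
    (tendsto_integral_max_mollifier_convolution_mul_fracLaplacian_sub hs0 hs1 hB hBc hu hv hφ2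
      hφ.hasCompactSupport) hrhs ?_
  filter_upwards [tendsto_mollifierBump_rOut (E := Rn n) |>.eventually_le_const hr] with k hk
  have hkK := (Metric.cthickening_mono hk (tsupport φ)).trans hrK
  have hU := continuous_mollifier_convolution k (hu.locallyIntegrable hp0)
  have hV := continuous_mollifier_convolution k (hv.locallyIntegrable hp0)
  exact (SubsolutionTest.max_convolution_le hs0 hs1 (contDiff_mollifier k)
    (hasCompactSupport_mollifier k) (even_mollifier k) (mollifier_nonneg k) (integral_mollifier k)
    hB hBc hL hD hu hv hF hG hφ2 hφ.hasCompactSupport hφ.nonneg hC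
    (hsubu _ (hφ.mollifier_convolution_indicator (isOpen_lt hV hU).measurableSet hkK))
    (hsubv _ (hφ.mollifier_convolution_indicator (isClosed_le hU hV).measurableSet hkK))).trans
    (add_le_add_left (integral_selectRhs_mul_le hU.aemeasurable hV.aemeasurable hum hvm hF hG hφm
      hA hφ.nonneg) _)

end MaxSubsolution

section Localization

lemma exists_contDiff_hasCompactSupport_eqOn {E F : Type*} [NormedAddCommGroup E]
    [NormedSpace ℝ E] [FiniteDimensional ℝ E] [NormedAddCommGroup F] [NormedSpace ℝ F] {m : ℕ∞}
    {b : E → F} {K U : Set E} (hK : IsCompact K) (hU : IsOpen U) (hKU : K ⊆ U)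
    (hb : ContDiffOn ℝ m b U) :
    ∃ B : E → F, ContDiff ℝ m B ∧ HasCompactSupport B ∧ EqOn B b K := by
  obtain ⟨L, hL, hKL, hLU⟩ := exists_compact_between hK hU hKU
  obtain ⟨χ, hχ1, hχ0, -⟩ := exists_contMDiffMap_one_nhds_of_subset_interior
    (modelWithCornersSelf ℝ E) (n := m) hK.isClosed hKL
  have hχL : tsupport χ ⊆ L :=
    closure_minimal (fun x hx => by_contra fun hxL => hx (hχ0 x hxL)) hL.isClosed
  have hχc : HasCompactSupport χ := hL.of_isClosed_subset (isClosed_tsupport _) hχL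
  refine ⟨fun x => χ x • b x, ?_, hχc.smul_right, fun x hx => ?_⟩
  · rw [← contMDiff_iff_contDiff]
    refine contMDiff_of_tsupport fun x hx => ContDiffAt.contMDiffAt ?_
    exact χ.contMDiff.contDiff.contDiffAt.smul
      (hb.contDiffAt (hU.mem_nhds (hLU (hχL (tsupport_smul_subset_left χ b hx)))))
  · simp only [hχ1.self_of_nhdsSet x hx, one_smul]

variable {n : ℕ} {s : ℝ} {Ω : Opens (Rn n)} {K : Set (Rn n)} {b B : Rn n → Rn n}
  {c u v w f g h : Rn n → ℝ} {ψ : 𝓓(Ω, ℝ)}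

lemma funDistr_eq_integral_indicator (hKΩ : K ⊆ Ω) (hψ : tsupport ψ ⊆ K) :
    funDistr h ψ = ∫ x, K.indicator h x * ψ x := by
  have hψ0 {x : Rn n} (hx : x ∉ K) : ψ x = 0 :=
    image_eq_zero_of_notMem_tsupport fun hxψ => hx (hψ hxψ)
  rw [funDistr, setIntegral_eq_integral_of_forall_compl_eq_zero fun x hx => by
    rw [hψ0 fun hxK => hx (hKΩ hxK), mul_zero]]
  congr 1 with x
  by_cases hx : x ∈ K
  · rw [indicator_of_mem hx]
  · rw [hψ0 hx, mul_zero, mul_zero]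

lemma funDistr_sub (hK : IsCompact K) (hKΩ : K ⊆ Ω) (hf : IntegrableOn f K)
    (hg : IntegrableOn g K) (hψ : tsupport ψ ⊆ K) :
    funDistr f ψ - funDistr g ψ = ∫ x, K.indicator (fun y => f y - g y) x * ψ x := by
  obtain ⟨A, hA⟩ := ψ.hasCompactSupport.exists_bound_of_continuous ψ.continuous
  have hint {k : Rn n → ℝ} (hk : IntegrableOn k K) : Integrable fun x => K.indicator k x * ψ x :=
    (hk.integrable_indicator hK.measurableSet).mul_bdd ψ.continuous.aestronglyMeasurable
      (.of_forall hA)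
  rw [funDistr_eq_integral_indicator hKΩ hψ, funDistr_eq_integral_indicator hKΩ hψ,
    ← integral_sub (hint hf) (hint hg)]
  congr 1 with x
  rw [← sub_mul, ← Pi.sub_apply, ← indicator_sub']
  rfl

lemma driftDistr_eq_integral (hKΩ : K ⊆ Ω) (hBb : EqOn B b K) (hψ : tsupport ψ ⊆ K) :
    driftDistr b w ψ = -∫ x, w x * divergence (fun y => ψ y • B y) x := by
  have hψb : (fun y => ψ y • b y) = fun y => ψ y • B y := by
    ext1 y
    by_cases hy : y ∈ K
    · rw [hBb hy]
    · rw [image_eq_zero_of_notMem_tsupport fun hyψ => hy (hψ hyψ), zero_smul, zero_smul]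
  rw [driftDistr, hψb, setIntegral_eq_integral_of_forall_compl_eq_zero fun x hx => ?_]
  rw [divergence_of_notMem_tsupport fun hxψ =>
    hx (hKΩ (hψ (tsupport_smul_subset_left _ B hxψ))), mul_zero]

lemma subsolutionTest_iff (hK : IsCompact K) (hKΩ : K ⊆ Ω) (hBb : EqOn B b K)
    (hh : IntegrableOn h K) (hcw : IntegrableOn (fun x => c x * w x) K) (hψ : tsupport ψ ⊆ K) :
    SubsolutionTest s B w (K.indicator fun x => h x - c x * w x) ψ ↔
      fracLaplacianDistr s w ψ + driftDistr b w ψ + funDistr (fun x => c x * w x) ψ ≤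
        funDistr h ψ := by
  rw [SubsolutionTest, ← funDistr_sub hK hKΩ hh hcw hψ, driftDistr_eq_integral hKΩ hBb hψ,
    le_sub_iff_add_le, sub_eq_add_neg]
  rfl

lemma IsSubsolution.subsolutionTest (hw : IsSubsolution Ω s b c w h) (hK : IsCompact K)
    (hKΩ : K ⊆ Ω) (hBb : EqOn B b K) (hh : IntegrableOn h K)
    (hcw : IntegrableOn (fun x => c x * w x) K) {φ : Rn n → ℝ} (hφ : IsTestIn K φ) :
    SubsolutionTest s B w (K.indicator fun x => h x - c x * w x) φ := by
  let ψ : 𝓓(Ω, ℝ) := ⟨φ, hφ.contDiff, hφ.hasCompactSupport, hφ.tsupport_subset.trans hKΩ⟩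
  exact (subsolutionTest_iff (ψ := ψ) hK hKΩ hBb hh hcw hφ.tsupport_subset).2 (hw ψ hφ.nonneg)

lemma IsSubsolution.max (hs0 : 0 < s) (hs1 : s < 1) (hb : ContDiffOn ℝ 1 b Ω)
    (hu : MemL (2 * s) u) (hv : MemL (2 * s) v)
    (hcu : LocallyIntegrableOn (fun x => c x * u x) Ω)
    (hcv : LocallyIntegrableOn (fun x => c x * v x) Ω) (hf : LocallyIntegrableOn f Ω)
    (hg : LocallyIntegrableOn g Ω) (hsubu : IsSubsolution Ω s b c u f)
    (hsubv : IsSubsolution Ω s b c v g) :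
    IsSubsolution Ω s b c (fun x => Max.max (u x) (v x)) (maxRhs u v f g) := by
  intro φ hφ0
  have hp0 : 0 ≤ n + 2 * s := by positivity
  rw [memL_iff_memW] at hu hv
  have hum := (hu.aestronglyMeasurable hp0).aemeasurable
  have hvm := (hv.aestronglyMeasurable hp0).aemeasurable
  obtain ⟨r, hr, hrΩ⟩ := φ.hasCompactSupport.isCompact.exists_cthickening_subset_open Ω.isOpen
    φ.tsupport_subset
  set K := Metric.cthickening r (tsupport φ)
  have hK : IsCompact K := φ.hasCompactSupport.isCompact.cthickening
  have hφK : tsupport φ ⊆ K := Metric.self_subset_cthickening _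
  obtain ⟨B, hB, hBc, hBb⟩ := exists_contDiff_hasCompactSupport_eqOn (m := 1) hK Ω.isOpen hrΩ hb
  have hint {k : Rn n → ℝ} (hk : LocallyIntegrableOn k Ω) : IntegrableOn k K :=
    hk.integrableOn_compact_subset hrΩ hK
  have hsub {k l : Rn n → ℝ} (hk : LocallyIntegrableOn k Ω) (hl : LocallyIntegrableOn l Ω) :
      Integrable (K.indicator fun x => k x - l x) :=
    ((hint hk).sub (hint hl)).integrable_indicator hK.measurableSet
  have hmax := SubsolutionTest.max hs0 hs1 hB hBc hu hv (hsub hf hcu) (hsub hg hcv)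
    ⟨φ.contDiff, φ.hasCompactSupport, hφ0, hφK⟩ hr subset_rfl
    (fun ψ hψ => hsubu.subsolutionTest hK hrΩ hBb (hint hf) (hint hcu) hψ)
    (fun ψ hψ => hsubv.subsolutionTest hK hrΩ hBb (hint hg) (hint hcv) hψ)
  rw [maxRhs_indicator, maxRhs_sub_mul] at hmax
  refine (subsolutionTest_iff hK hrΩ hBb (hint (locallyIntegrableOn_maxRhs hum hvm hf hg)) ?_
    hφK).1 hmax
  exact maxRhs_mul (u := u) c ▸ hint (locallyIntegrableOn_maxRhs hum hvm hcu hcv)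

lemma locallyIntegrableOn_mul_of_memLp_top (hc : MemLp c ∞ (volume.restrict Ω))
    (hw : LocallyIntegrable w) : LocallyIntegrableOn (fun x => c x * w x) Ω :=
  (locallyIntegrableOn_iff Ω.isOpen.isLocallyClosed).2 fun _ hKΩ hK =>
    (hw.integrableOn_isCompact hK).mul_of_top_right
      (hc.mono_measure (Measure.restrict_mono hKΩ le_rfl))

end Localization

end FracMax

end

theorem theorem1p7_general {n : ℕ} {s : ℝ} (hs0 : 0 < s) (hs1 : s < 1) {Ω : Opens (FracMax.Rn n)}
    {b : FracMax.Rn n → FracMax.Rn n} (hb : ContDiffOn ℝ 1 b Ω) {c u v f g : FracMax.Rn n → ℝ}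
    (hu : FracMax.MemL (2 * s) u) (hv : FracMax.MemL (2 * s) v)
    (hcu : LocallyIntegrableOn (fun x => c x * u x) Ω)
    (hcv : LocallyIntegrableOn (fun x => c x * v x) Ω)
    (hf : LocallyIntegrableOn f Ω) (hg : LocallyIntegrableOn g Ω)
    (hsubu : FracMax.IsSubsolution Ω s b c u f) (hsubv : FracMax.IsSubsolution Ω s b c v g) :
    FracMax.MemL (2 * s) (fun x => max (u x) (v x)) ∧
    LocallyIntegrableOn (FracMax.maxRhs u v f g) Ω ∧
    FracMax.IsSubsolution Ω s b c (fun x => max (u x) (v x)) (FracMax.maxRhs u v f g) := by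
  have hu' := FracMax.memL_iff_memW.1 hu
  have hv' := FracMax.memL_iff_memW.1 hv
  have hp0 : 0 ≤ n + 2 * s := by positivity
  exact ⟨FracMax.memL_iff_memW.2 (hu'.max hv'),
    FracMax.locallyIntegrableOn_maxRhs (hu'.aestronglyMeasurable hp0).aemeasurable
      (hv'.aestronglyMeasurable hp0).aemeasurable hf hg,
    .max hs0 hs1 hb hu hv hcu hcv hf hg hsubu hsubv⟩

theorem theorem1p7 (n : ℕ) (hn : 1 ≤ n) (s : ℝ) (hs0 : 0 < s) (hs1 : s < 1)
    (Ω : Opens (FracMax.Rn n)) (hΩ : IsConnected (Ω : Set (FracMax.Rn n)))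
    (b : FracMax.Rn n → FracMax.Rn n) (hb : FracMax.BoundedC1On b Ω)
    (c : FracMax.Rn n → ℝ) (hc : MemLp c ∞ (volume.restrict (Ω : Set (FracMax.Rn n))))
    (u v f g : FracMax.Rn n → ℝ)
    (hu : FracMax.MemL (2 * s) u) (hv : FracMax.MemL (2 * s) v)
    (hf : LocallyIntegrableOn f (Ω : Set (FracMax.Rn n)) volume)
    (hg : LocallyIntegrableOn g (Ω : Set (FracMax.Rn n)) volume)
    (hsubu : FracMax.IsSubsolution Ω s b c u f)
    (hsubv : FracMax.IsSubsolution Ω s b c v g) :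
    FracMax.MemL (2 * s) (fun x => max (u x) (v x)) ∧
    LocallyIntegrableOn (FracMax.maxRhs u v f g) (Ω : Set (FracMax.Rn n)) volume ∧
    FracMax.IsSubsolution Ω s b c (fun x => max (u x) (v x)) (FracMax.maxRhs u v f g) := by
  have hloc {w : FracMax.Rn n → ℝ} (hw : FracMax.MemL (2 * s) w) :=
    FracMax.locallyIntegrableOn_mul_of_memLp_top hc
      ((FracMax.memL_iff_memW.1 hw).locallyIntegrable (by positivity))
  exact theorem1p7_general hs0 hs1 hb.1 hu hv (hloc hu) (hloc hv) hf hg hsubu hsubv
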